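/- **Setting.** For $\rho\in[0,1]$ let $\mathcal N_\rho(x)=x\oplus e$ with $e\leftarrow\mathrm{Ber}((1-\rho)/2)^n$. A zero-bit code consists of randomized algorithms $\mathsf{KeyGen}$, $\mathsf{Enc}(\mathsf{sk})\in\{0,1\}^n$ and $\mathsf{Dec}(\mathsf{sk},x)\in\{1,\bot\}$. It is a $(\delta,\varepsilon,\mu)$-PRC for $\mathcal N_\rho$ against $q$-query adversaries ($q\in\mathbb N\cup\{\infty\}$) if, for $\mathsf{sk}\leftarrow\mathsf{KeyGen}$: * (completeness) $\Pr[\mathsf{Dec}(\mathsf{sk},\mathcal N_\rho(\mathsf{Enc}(\mathsf{sk})))=1]\ge 1-\delta$; * (statistical pseudorandomness) every computationally unbounded randomized adversary that receives at most $q$ fresh encodings under the same key distinguishes them from independent uniform words with advantage at most $\varepsilon$; * (soundness) $\Pr[\mathsf{Dec}(\mathsf{sk},c^*)=\bot]\ge 1-\mu$ for every fixed $c^*\in\{0,1\}^n$. In the standard model keys are bit strings and there is no oracle. In the (secret) random oracle model with security parameter $\lambda$, $\mathsf{Enc}$ and $\mathsf{Dec}$ (but neither $\mathsf{KeyGen}$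 nor the adversary) also query one uniformly random function $\mathcal R:\{0,1\}^\lambda\to\{0,1\}$, drawn once and shared by all their runs, and all probabilities include the choice of $\mathcal R$. **Lemma.** There is an absolute constant $C>0$ such that the following holds. Let $n,\ell,Q:\mathbb N\to\mathbb N$, $q:\mathbb N\to\mathbb N\cup\{\infty\}$, $\rho:\mathbb N\to[0,1]$, $\tau:\mathbb N\to(0,1)$ and $\delta,\varepsilon,\mu:\mathbb N\to\mathbb R$ be functions of the security parameter $\lambda\ge1$ (the dependence on $\lambda$ is left implicit). Let $(\mathsf{KeyGen},\mathsf{Enc}^{\mathcal R},\mathsf{Dec}^{\mathcal R})$ be a zero-bit $(\delta,\varepsilon,\mu)$-PRC in the random oracle model, for $\mathcal N_\rho$ and against $q$-query adversaries, whose keys have length at most $\ell$ and where each run of $\mathsf{Enc}^{\mathcal R}$ and of $\mathsf{Dec}^{\mathcal R}$ makes at most $Q$ queries. Suppose that $q\ge1$ and that either $q=\infty$, or $m\,\varepsilon n\ge \ell+Q\lambda^2/\tau$ for some integer $m\le q$. Put $$\delta'=\delta+2^{-\lambda}\,\frac Q\tau+Q^2\,\tau^{\frac12\cdot\frac{1-\rho^2}{1+\rho^2}}+C\,Q^2\sqrt{\varepsilon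 n}.$$ Consider the following compiled scheme $(\mathsf{KeyGen}',\mathsf{Enc}'_0,\mathsf{Dec}')$ in the standard model. $\mathsf{KeyGen}'$ samples $\mathsf{sk}\leftarrow\mathsf{KeyGen}$ and a random $F_0:\{0,1\}^\lambda\to\{0,1\}$, runs $\mathsf{Dec}^{F_0}(\mathsf{sk},x)$ on $\lceil\lambda/\tau\rceil$ independent uniform words $x$, records all query-response pairs in a table $S$, and outputs a bit-string encoding of $\mathsf{sk}'=(\mathsf{sk},S)$. $\mathsf{Enc}'_0(\mathsf{sk}')$ samples a fresh uniformly random function $F_1$ consistent with $S$ and runs $\mathsf{Enc}^{F_1}(\mathsf{sk})$. $\mathsf{Dec}'(\mathsf{sk}',x)$ samples a fresh uniformly random function $F_2$ consistent with $S$ and runs $\mathsf{Dec}^{F_2}(\mathsf{sk},x)$. Then: 1. There is an encoder $\mathsf{Enc}'$ such that $(\mathsf{KeyGen}',\mathsf{Enc}',\mathsf{Dec}')$ is a $(\delta',\varepsilon,\mu)$-PRC in the standard model for $\mathcal N_\rho$ and against $q$-query adversaries, with keys of length at most $\ell+C\,Q\lambda^2/\tau$. 2. The scheme $(\mathsf{KeyGen}',\mathsf{Enc}'_0,\mathsf{Dec}')$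 itself is a $(\delta',\varepsilon,\mu)$-PRC for $\mathcal N_\rho$ against adversaries that receive one encoding. 3. The key stores the $\tau$-heavy decoder queries: except with probability at most $2^{-\lambda}Q/\tau$ over $\mathsf{KeyGen}'$, the table $S$ contains every query that $\mathsf{Dec}^{F_0}(\mathsf{sk},x)$ makes with probability at least $\tau$ over uniform $x\in\{0,1\}^n$ and the coins of $\mathsf{Dec}$. -/

import Mathlib

namespace PRC

/-- Bit strings of length `n`. -/
abbrev Word (n : ℕ) : Type := Fin n → Bool

/-- Oracles `{0,1}^lam → {0,1}`; a random oracle is a uniformly random element. -/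
abbrev Oracle (lam : ℕ) : Type := Word lam → Bool

/-- The probability of the outcome `a` under `p`, as a real number. -/
noncomputable def prob {α : Type} (p : PMF α) (a : α) : ℝ := (p a).toReal

/-- `m` independent samples from `p`. -/
noncomputable def iid {α : Type} (p : PMF α) : (m : ℕ) → PMF (Fin m → α)
  | 0 => PMF.pure Fin.elim0
  | m + 1 => p.bind fun a => (iid p m).map fun v => (Fin.cons a v : Fin (m + 1) → α)

/-- The bit that is `true` with probability `(1-ρ)/2`. -/
noncomputable def flipBit (ρ : unitInterval) : PMF Bool :=
  PMF.ofFintype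
    (fun b => if b then ENNReal.ofReal ((1 - (ρ : ℝ)) / 2) else ENNReal.ofReal ((1 + (ρ : ℝ)) / 2))
    (by
      have h0 := ρ.2.1
      have h1 := ρ.2.2
      rw [Fintype.sum_bool]
      simp only [if_true, Bool.false_eq_true, if_false]
      rw [← ENNReal.ofReal_add (by linarith) (by linarith), ← ENNReal.ofReal_one]
      congr 1
      ring)

/-- The binary symmetric channel `N_ρ(x) = x ⊕ e` with `e ← Ber((1-ρ)/2)^n`. -/
noncomputable def noise (ρ : unitInterval) {n : ℕ} (x : Word n) : PMF (Word n) :=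
  (iid (flipBit ρ) n).map fun e i => xor (x i) (e i)

/-! ### Zero-bit codes -/

/-- A zero-bit secret-key coding scheme with (shared secret) keys in `K` and codewords in
`{0,1}^n`.  The decoder's output `true` is the message `1`, its output `false` is `⊥`. -/
structure Code (K : Type) (n : ℕ) where
  keyGen : PMF K
  enc : K → PMF (Word n)
  dec : K → Word n → PMF Bool

namespace Code

variable {K : Type} {n : ℕ}

/-- `δ`-completeness for the channel `N_ρ`. -/
def Complete (P : Code K n) (ρ : unitInterval) (δ : ℝ) : Prop :=
  1 - δ ≤ prob (P.keyGen.bind fun k => (P.enc k).bind fun c => (noise ρ c).bind fun c' =>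
    P.dec k c') true

/-- Statistical `ε`-pseudorandomness against all (computationally unbounded, randomized)
adversaries that request at most `q` fresh encodings under one key; `q = ⊤` means that the number
of requests is not bounded.  The encoding oracle of a zero-bit code has no input, so an adversary
is a randomized test of the codewords that it receives. -/
def Pseudorandom (P : Code K n) (q : ℕ∞) (ε : ℝ) : Prop :=
  ∀ m : ℕ, (m : ℕ∞) ≤ q → ∀ A : (Fin m → Word n) → PMF Bool,
    |prob (P.keyGen.bind fun k => (iid (P.enc k) m).bind A) true -
      prob ((iid (PMF.uniformOfFintype (Word n)) m).bind A) true| ≤ ε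

/-- `μ`-soundness: every fixed word is rejected except with probability `μ`. -/
def Sound (P : Code K n) (μ : ℝ) : Prop :=
  ∀ c : Word n, 1 - μ ≤ prob (P.keyGen.bind fun k => P.dec k c) false

/-- A zero-bit `(δ, ε, μ)`-pseudorandom code for the channel `N_ρ`, where pseudorandomness holds
against all adversaries that make at most `q` queries. -/
structure IsPRC (P : Code K n) (ρ : unitInterval) (q : ℕ∞) (δ ε μ : ℝ) : Prop where
  complete : P.Complete ρ δ
  pseudorandom : P.Pseudorandom q ε
  sound : P.Sound μ

end Code

/-! ### Algorithms with oracle access -/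

/-- Deterministic oracle algorithms with output in `α`, as adaptive decision trees.  A randomized
oracle algorithm is a distribution over them (it draws its coins first). -/
inductive QueryTree (lam : ℕ) (α : Type) : Type
  | output (a : α) : QueryTree lam α
  | query (x : Word lam) (next : Bool → QueryTree lam α) : QueryTree lam α

namespace QueryTree

variable {lam : ℕ} {α : Type}

/-- The output of the algorithm when its oracle is `F`. -/
def eval (F : Oracle lam) : QueryTree lam α → α
  | output a => a
  | query x next => (next (F x)).eval F

/-- The query-response pairs of the run with oracle `F`, in order. -/
def transcript (F : Oracle lam) : QueryTree lam α → List (Word lam × Bool)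
  | output _ => []
  | query x next => (x, F x) :: (next (F x)).transcript F

/-- At most `Q` queries are made, whatever the oracle is. -/
def QueriesAtMost (T : QueryTree lam α) (Q : ℕ) : Prop :=
  ∀ F : Oracle lam, (T.transcript F).length ≤ Q

end QueryTree

/-- A zero-bit coding scheme in the random oracle model, at security parameter `lam`.  Keys are
bit strings, the encoder and the decoder have access to an oracle, key generation does not. -/
structure ROCode (lam n : ℕ) where
  keyGen : PMF (List Bool)
  enc : List Bool → PMF (QueryTree lam (Word n))
  dec : List Bool → Word n → PMF (QueryTree lam Bool)

/-- A zero-bit coding scheme in the standard model: keys are bit strings. -/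
abbrev StdCode (n : ℕ) : Type := Code (List Bool) n

namespace ROCode

variable {lam n : ℕ}

/-- The scheme run with a secret random oracle: a uniformly random oracle is drawn once and shared
by all runs of the encoder and of the decoder; adversaries have no access to it. -/
noncomputable def inROM (P : ROCode lam n) : Code (List Bool × Oracle lam) n where
  keyGen := P.keyGen.bind fun sk => (PMF.uniformOfFintype (Oracle lam)).map fun R => (sk, R)
  enc k := (P.enc k.1).map fun T => T.eval k.2
  dec k c := (P.dec k.1 c).map fun T => T.eval k.2

/-- Each run of the encoder and of the decoder makes at most `Q` oracle queries. -/
def QueriesAtMost (P : ROCode lam n) (Q : ℕ) : Prop :=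
  ∀ sk ∈ P.keyGen.support,
    (∀ T ∈ (P.enc sk).support, T.QueriesAtMost Q) ∧
      ∀ c, ∀ T ∈ (P.dec sk c).support, T.QueriesAtMost Q

end ROCode

/-! ### The compiler -/

/-- One slot of a table of query-response pairs, on `lam + 2` bits; the first bit says whether the
slot is used. -/
def encodeSlot {lam : ℕ} : Option (Word lam × Bool) → List Bool
  | none => List.replicate (lam + 2) false
  | some (x, b) => true :: b :: List.ofFn x

def decodeSlot (lam : ℕ) (l : List Bool) : Option (Word lam × Bool) :=
  if l.getD 0 false then some (fun i => l.getD (i + 2) false, l.getD 1 false) else none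

/-- The key `(sk, S)` as a bit string: `N` slots for the table `S`, followed by `sk`. -/
def encodeKey {lam : ℕ} (N : ℕ) (sk : List Bool) (S : List (Word lam × Bool)) : List Bool :=
  (List.range N).flatMap (fun i => encodeSlot S[i]?) ++ sk

/-- Recovers `(sk, S)`. -/
def parseKey (lam N : ℕ) (k : List Bool) : List Bool × List (Word lam × Bool) :=
  (k.drop (N * (lam + 2)),
    (List.range N).filterMap fun i => decodeSlot lam ((k.drop (i * (lam + 2))).take (lam + 2)))

/-- A uniformly random oracle among those consistent with the table `S`: the answers in `S`, and
independent uniform bits elsewhere. -/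
noncomputable def consistentOracle {lam : ℕ} (S : List (Word lam × Bool)) : PMF (Oracle lam) :=
  (PMF.uniformOfFintype (Oracle lam)).map fun G x => (S.lookup x).getD (G x)

/-- The query-response pairs of one run of the decoder with key `sk` and oracle `F` on a uniformly
random word. -/
noncomputable def decoderRun {lam n : ℕ} (P : ROCode lam n) (sk : List Bool) (F : Oracle lam) :
    PMF (List (Word lam × Bool)) :=
  (PMF.uniformOfFintype (Word n)).bind fun x => (P.dec sk x).map fun T => T.transcript F

/-- The table of the query-response pairs of `N` independent such runs. -/
noncomputable def decoderTable {lam n : ℕ} (P : ROCode lam n) (N : ℕ) (sk : List Bool)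
    (F : Oracle lam) : PMF (List (Word lam × Bool)) :=
  (iid (decoderRun P sk F) N).map fun v => (List.ofFn v).flatten

/-- The query `x` is `τ`-heavy for `sk` and `F`: the decoder asks it with probability at least `τ`
on a uniformly random word. -/
def Heavy {lam n : ℕ} (P : ROCode lam n) (τ : ℝ) (sk : List Bool) (F : Oracle lam)
    (x : Word lam) : Prop :=
  τ ≤ prob ((decoderRun P sk F).map fun t => ∃ b, (x, b) ∈ t) True

/-- The compiled scheme with threshold `τ`, for a scheme with at most `Q` queries.  The new key
stores the query-response pairs of `⌈lam / τ⌉` runs of the decoder on random words; the encoder and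
the decoder run the original algorithms, each with its own fresh oracle consistent with them. -/
noncomputable def compile {lam n : ℕ} (P : ROCode lam n) (Q : ℕ) (τ : ℝ) : StdCode n where
  keyGen := P.keyGen.bind fun sk => (PMF.uniformOfFintype (Oracle lam)).bind fun F₀ =>
    (decoderTable P ⌈lam / τ⌉₊ sk F₀).map fun S => encodeKey (Q * ⌈lam / τ⌉₊) sk S
  enc k :=
    let s := parseKey lam (Q * ⌈lam / τ⌉₊) k
    (consistentOracle s.2).bind fun F₁ => (P.enc s.1).map fun T => T.eval F₁
  dec k c :=
    let s := parseKey lam (Q * ⌈lam / τ⌉₊) k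
    (consistentOracle s.2).bind fun F₂ => (P.dec s.1 c).map fun T => T.eval F₂

/-- The probability that, in the key generation of the compiled scheme, the stored table misses some
`τ`-heavy query of the decoder. -/
noncomputable def missProbability {lam n : ℕ} (P : ROCode lam n) (τ : ℝ) : ℝ :=
  prob (P.keyGen.bind fun sk => (PMF.uniformOfFintype (Oracle lam)).bind fun F₀ =>
    (decoderTable P ⌈lam / τ⌉₊ sk F₀).map fun S =>
      ∃ x, Heavy P τ sk F₀ x ∧ ∀ b, (x, b) ∉ S) True

/-- The completeness error of the compiled scheme, where `C` is the constant in `O(Q²√(εn))`. -/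
noncomputable def compiledError (C ρ : ℝ) (lam n Q : ℕ) (τ δ ε : ℝ) : ℝ :=
  δ + (2⁻¹ : ℝ) ^ lam * Q / τ + (Q : ℝ) ^ 2 * τ ^ ((1 / 2 : ℝ) * ((1 - ρ ^ 2) / (1 + ρ ^ 2)))
    + C * ((Q : ℝ) ^ 2 * √(ε * n))

end PRC

/-! Everything that involves a single run of the encoder or of the decoder carries over exactly. By
lazy sampling, a fresh oracle consistent with the table `S` has, jointly with `sk` and `S`, the law
of the oracle that produced `S` (`ex_tableKey_consistentOracle`). This gives soundness and
pseudorandomness of one codeword without any loss.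

Completeness is where sharing the oracle matters. Giving the decoder an independent consistent
oracle can only hurt if encoder and decoder ask a common query outside `S` (`ex_shared_oracle_le`).
Heavy queries are in `S` except with probability `2^{-λ}Q/τ`. For a light query, suppose first that
the codeword is uniform: the decoder then sees a noisy copy of a uniform word, and Bonami's
inequality `‖T_ρ f‖₂ ≤ ‖f‖_{1+ρ²}` together with Cauchy-Schwarz bounds the chance of a common light
query by `Q τ^{(1/2)(1-ρ²)/(1+ρ²)}` (`light_collision`).

The codeword is not uniform given the key, but it nearly is on average. The compiled key is short,
and `m` codewords of the random oracle scheme are jointly close to uniform. Conditioning on the key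
can raise the relative entropy of the `m` codewords by at most about the key length, and at least
one of `m` equal shares of the total must account for each marginal; Pinsker's inequality turns the
share into an average distance `O(√(εn))` (`average_entropy_le`, `average_distUniform_le_sqrt`).

The same closeness supplies the many-time encoder: for `Q ≥ 1` it simply outputs uniform words.
Pseudorandomness is then trivial for any number of queries, and completeness pays the distance
`O(√(εn))` once more. For `Q = 0` there is no oracle to replace and the compiled encoder is kept. -/

namespace PRC
open scoped ENNReal

/-! ### Expectations -/

/-- The expectation of a nonnegative function. -/
noncomputable def ex {α : Type} (p : PMF α) (f : α → ℝ≥0∞) : ℝ≥0∞ := ∑' a, p a * f a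

section ex

variable {α β : Type} (p : PMF α)

theorem ex_bind (k : α → PMF β) (f : β → ℝ≥0∞) :
    ex (p.bind k) f = ex p fun a => ex (k a) f := by
  simp only [ex, PMF.bind_apply, ← ENNReal.tsum_mul_right, ← ENNReal.tsum_mul_left]
  rw [ENNReal.tsum_comm]
  simp only [mul_assoc]

theorem ex_pure (a : α) (f : α → ℝ≥0∞) : ex (PMF.pure a) f = f a := by
  unfold ex
  rw [tsum_eq_single a]
  · simp
  · intro b hb
    simp [hb]

theorem ex_map (g : α → β) (f : β → ℝ≥0∞) : ex (p.map g) f = ex p fun a => f (g a) := by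
  rw [← PMF.bind_pure_comp, ex_bind]
  simp [ex_pure]

theorem ex_congr {f g : α → ℝ≥0∞} (h : ∀ a ∈ p.support, f a = g a) : ex p f = ex p g := by
  refine tsum_congr fun a => ?_
  by_cases ha : p a = 0
  · simp [ha]
  · rw [h a ((PMF.mem_support_iff _ _).2 ha)]

theorem ex_le_ex {f g : α → ℝ≥0∞} (h : ∀ a ∈ p.support, f a ≤ g a) : ex p f ≤ ex p g := by
  refine ENNReal.tsum_le_tsum fun a => ?_
  by_cases ha : p a = 0
  · simp [ha]
  · gcongr
    exact h a ((PMF.mem_support_iff _ _).2 ha)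

theorem ex_const (c : ℝ≥0∞) : ex p (fun _ => c) = c := by
  simp [ex, ENNReal.tsum_mul_right]

theorem ex_le_const {f : α → ℝ≥0∞} {c : ℝ≥0∞} (h : ∀ a ∈ p.support, f a ≤ c) : ex p f ≤ c :=
  (ex_le_ex p h).trans (ex_const p c).le

theorem ex_add (f g : α → ℝ≥0∞) : ex p (fun a => f a + g a) = ex p f + ex p g := by
  simp [ex, mul_add, ENNReal.tsum_add]

theorem ex_const_mul (c : ℝ≥0∞) (f : α → ℝ≥0∞) : ex p (fun a => c * f a) = c * ex p f := by
  simp only [ex, ← ENNReal.tsum_mul_left]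
  exact tsum_congr fun a => by ring

theorem ex_mul_const (c : ℝ≥0∞) (f : α → ℝ≥0∞) : ex p (fun a => f a * c) = ex p f * c := by
  simp only [mul_comm _ c, ex_const_mul]

theorem ex_sum {ι : Type} (s : Finset ι) (f : ι → α → ℝ≥0∞) :
    ex p (fun a => ∑ i ∈ s, f i a) = ∑ i ∈ s, ex p (f i) := by
  simp only [ex, Finset.mul_sum]
  exact Summable.tsum_finsetSum fun _ _ => ENNReal.summable

theorem ex_comm (q : PMF β) (f : α → β → ℝ≥0∞) :
    (ex p fun a => ex q fun b => f a b) = ex q fun b => ex p fun a => f a b := by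
  simp only [ex, ← ENNReal.tsum_mul_left]
  rw [ENNReal.tsum_comm]
  exact tsum_congr fun b => tsum_congr fun a => by ring

theorem ex_eq_sum [Fintype α] (f : α → ℝ≥0∞) : ex p f = ∑ a, p a * f a := tsum_fintype _

theorem ex_uniform [Fintype α] [Nonempty α] (f : α → ℝ≥0∞) :
    ex (PMF.uniformOfFintype α) f = (Fintype.card α : ℝ≥0∞)⁻¹ * ∑ a, f a := by
  simp [ex_eq_sum, Finset.mul_sum]

theorem ex_le_support_sum (s : Finset α) (hs : ∀ a ∈ p.support, a ∈ s) (f : α → ℝ≥0∞) :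
    ex p f = ∑ a ∈ s, p a * f a := by
  refine tsum_eq_sum fun a ha => ?_
  have : p a = 0 := by
    by_contra h
    exact ha (hs a ((PMF.mem_support_iff _ _).2 h))
  simp [this]

theorem apply_eq_ex [DecidableEq α] (a : α) : p a = ex p fun x => if x = a then 1 else 0 := by
  unfold ex
  rw [tsum_eq_single a]
  · simp
  · intro b hb
    simp [hb]

theorem apply_true_eq_ex (p : PMF Bool) : p true = ex p fun x => if x then 1 else 0 := by
  simp [ex_eq_sum]

theorem bind_apply_eq_ex (k : α → PMF β) (b : β) : (p.bind k) b = ex p fun a => k a b := rfl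

open Classical in
theorem map_true_eq_ex (g : α → Prop) : (p.map g) True = ex p fun a => if g a then 1 else 0 := by
  rw [apply_eq_ex, ex_map]
  simp only [eq_iff_iff, iff_true]

/-- Indicators are among the test functions. This reduces equality of two experiments to identities
between nonnegative expectations, where all exchanges of order are free. -/
theorem bind_eq_of_ex {p : PMF α} {q : PMF β} {γ : Type} {f : α → PMF γ} {g : β → PMF γ}
    (h : ∀ φ : γ → ℝ≥0∞, (ex p fun a => ex (f a) φ) = ex q fun b => ex (g b) φ) :
    p.bind f = q.bind g := by
  classical
  ext c
  rw [apply_eq_ex, apply_eq_ex, ex_bind, ex_bind, h]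

theorem ex_iid_zero (f : (Fin 0 → α) → ℝ≥0∞) : ex (iid p 0) f = f Fin.elim0 := ex_pure _ _

theorem ex_iid_succ (m : ℕ) (f : (Fin (m + 1) → α) → ℝ≥0∞) :
    ex (iid p (m + 1)) f = ex p fun a => ex (iid p m) fun v => f (Fin.cons a v) := by
  simp only [iid, ex_bind, ex_map]

theorem ex_iid_one (f : (Fin 1 → α) → ℝ≥0∞) : ex (iid p 1) f = ex p fun a => f fun _ => a := by
  rw [ex_iid_succ]
  simp only [ex_iid_zero]
  congr! 3 with a
  ext i
  fin_cases i
  rfl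

theorem ex_iid_apply (m : ℕ) (i : Fin m) (f : α → ℝ≥0∞) :
    (ex (iid p m) fun v => f (v i)) = ex p f := by
  induction m with
  | zero => exact i.elim0
  | succ m ih =>
    rw [ex_iid_succ]
    refine Fin.cases ?_ (fun j => ?_) i
    · simp [ex_const]
    · simp [ih, ex_const]

theorem ex_iid_prod (m : ℕ) (f : α → ℝ≥0∞) :
    (ex (iid p m) fun v => ∏ i, f (v i)) = ex p f ^ m := by
  induction m with
  | zero => simp [ex_iid_zero]
  | succ m ih =>
    simp only [ex_iid_succ, Fin.prod_univ_succ, Fin.cons_zero, Fin.cons_succ, ex_const_mul, ih,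
      ex_mul_const]
    rw [pow_succ, mul_comm]

theorem iid_map (g : α → β) (m : ℕ) : iid (p.map g) m = (iid p m).map fun v i => g (v i) := by
  induction m with
  | zero =>
    rw [iid, iid, PMF.pure_map]
    congr 1
    ext i
    exact i.elim0
  | succ m ih =>
    rw [iid, iid, PMF.bind_map, PMF.map_bind, ih]
    congr 1
    ext1 a
    simp only [Function.comp, PMF.map_comp]
    congr 1
    ext v i
    refine Fin.cases ?_ (fun j => ?_) i <;> simp

theorem iid_support {m : ℕ} {v : Fin m → α} (hv : v ∈ (iid p m).support) (i : Fin m) :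
    v i ∈ p.support := by
  induction m with
  | zero => exact i.elim0
  | succ m ih =>
    simp only [iid, PMF.mem_support_bind_iff, PMF.mem_support_map_iff] at hv
    obtain ⟨a, ha, w, hw, rfl⟩ := hv
    refine Fin.cases ?_ (fun j => ?_) i
    · simpa using ha
    · simpa using ih hw j

theorem iid_uniform (α : Type) [Fintype α] [Nonempty α] (m : ℕ) :
    iid (PMF.uniformOfFintype α) m = PMF.uniformOfFintype (Fin m → α) := by
  classical
  have h : ∀ v : Fin m → α, iid (PMF.uniformOfFintype α) m v = ((Fintype.card α : ℝ≥0∞)⁻¹) ^ m := by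
    intro v
    rw [apply_eq_ex]
    induction m with
    | zero =>
      rw [ex_iid_zero, if_pos (Subsingleton.elim _ _), pow_zero]
    | succ m ih =>
      rw [ex_iid_succ]
      have : ∀ a w, (if (Fin.cons a w : Fin (m + 1) → α) = v then (1 : ℝ≥0∞) else 0)
          = (if a = v 0 then 1 else 0) * (if w = Fin.tail v then 1 else 0) := by
        intro a w
        rw [ite_zero_mul_ite_zero, one_mul]
        refine if_congr ?_ rfl rfl
        rw [← Fin.cons_self_tail v, Fin.cons_inj]
        simp
      simp only [this, ex_const_mul, ex_mul_const]
      rw [← apply_eq_ex, PMF.uniformOfFintype_apply, pow_succ', ih]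
  ext v
  rw [h, PMF.uniformOfFintype_apply, Fintype.card_fun, Fintype.card_fin]
  push_cast
  rw [ENNReal.inv_pow]

end ex

/-! ### Hypercontractivity of the noise operator -/

/-- The difference of the two sides vanishes at `t = 0` and is increasing: the powers `(1 ±
t)^(r-1)` in its derivative have product at least `1`, hence sum at least `2`. -/
theorem two_mul_le_rpow_sub_rpow {r t : ℝ} (hr0 : 0 ≤ r) (hr1 : r ≤ 1) (ht0 : 0 ≤ t)
    (ht1 : t ≤ 1) : 2 * r * t ≤ (1 + t) ^ r - (1 - t) ^ r := by
  have hmono : MonotoneOn (fun t : ℝ => (1 + t) ^ r - (1 - t) ^ r - 2 * r * t) (Set.Icc 0 1) := by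
    refine monotoneOn_of_hasDerivWithinAt_nonneg
      (f' := fun t => r * (1 + t) ^ (r - 1) + r * (1 - t) ^ (r - 1) - 2 * r)
      (convex_Icc 0 1) ?_ ?_ ?_
    · refine Continuous.continuousOn ?_
      have h1 : Continuous fun t : ℝ => (1 + t) ^ r :=
        (by fun_prop : Continuous fun t : ℝ => 1 + t).rpow_const fun _ => Or.inr hr0
      have h2 : Continuous fun t : ℝ => (1 - t) ^ r :=
        (by fun_prop : Continuous fun t : ℝ => 1 - t).rpow_const fun _ => Or.inr hr0
      fun_prop
    · intro x hx
      rw [interior_Icc] at hx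
      refine HasDerivAt.hasDerivWithinAt ?_
      have h1 : HasDerivAt (fun t : ℝ => (1 + t) ^ r) (1 * r * (1 + x) ^ (r - 1)) x :=
        ((hasDerivAt_id x).const_add 1).rpow_const (Or.inl (by simp only [id]; linarith [hx.1]))
      have h2 : HasDerivAt (fun t : ℝ => (1 - t) ^ r) (-1 * r * (1 - x) ^ (r - 1)) x :=
        ((hasDerivAt_id x).const_sub 1).rpow_const (Or.inl (by simp only [id]; linarith [hx.2]))
      have h3 : HasDerivAt (fun t : ℝ => 2 * r * t) (2 * r * 1) x :=
        (hasDerivAt_id x).const_mul (2 * r)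
      exact ((h1.sub h2).sub h3).congr_deriv (by ring)
    · intro x hx
      rw [interior_Icc] at hx
      have ha : 0 < 1 + x := by linarith [hx.1]
      have hb : 0 < 1 - x := by linarith [hx.2]
      set u := (1 + x) ^ (r - 1)
      set v := (1 - x) ^ (r - 1)
      have hu : 0 < u := Real.rpow_pos_of_pos ha _
      have hv : 0 < v := Real.rpow_pos_of_pos hb _
      have huv : 1 ≤ u * v := by
        rw [← Real.mul_rpow ha.le hb.le]
        refine Real.one_le_rpow_of_pos_of_le_one_of_nonpos (by positivity) ?_ (by linarith)
        nlinarith [hx.1]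
      have : 2 ≤ u + v := by nlinarith [sq_nonneg (u - v)]
      nlinarith
  have := hmono ⟨le_rfl, zero_le_one⟩ ⟨ht0, ht1⟩ ht0
  simp only [add_zero, sub_zero, Real.one_rpow, mul_zero, sub_self] at this
  linarith

/-- After doubling, the difference has derivative `p` times the difference in the preceding
inequality with `r = p - 1`. -/
theorem one_add_mul_sq_le_rpow_add_rpow {p t : ℝ} (hp1 : 1 ≤ p) (hp2 : p ≤ 2) (ht0 : 0 ≤ t)
    (ht1 : t ≤ 1) : 1 + p / 2 * ((p - 1) * t ^ 2) ≤ ((1 + t) ^ p + (1 - t) ^ p) / 2 := by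
  have hmono : MonotoneOn (fun t : ℝ => (1 + t) ^ p + (1 - t) ^ p - p * (p - 1) * t ^ 2)
      (Set.Icc 0 1) := by
    refine monotoneOn_of_hasDerivWithinAt_nonneg
      (f' := fun t => p * ((1 + t) ^ (p - 1) - (1 - t) ^ (p - 1) - 2 * (p - 1) * t))
      (convex_Icc 0 1) ?_ ?_ ?_
    · refine Continuous.continuousOn ?_
      have h1 : Continuous fun t : ℝ => (1 + t) ^ p :=
        (by fun_prop : Continuous fun t : ℝ => 1 + t).rpow_const fun _ => Or.inr (by linarith)
      have h2 : Continuous fun t : ℝ => (1 - t) ^ p :=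
        (by fun_prop : Continuous fun t : ℝ => 1 - t).rpow_const fun _ => Or.inr (by linarith)
      fun_prop
    · intro x hx
      rw [interior_Icc] at hx
      refine HasDerivAt.hasDerivWithinAt ?_
      have h1 : HasDerivAt (fun t : ℝ => (1 + t) ^ p) (1 * p * (1 + x) ^ (p - 1)) x :=
        ((hasDerivAt_id x).const_add 1).rpow_const (Or.inr hp1)
      have h2 : HasDerivAt (fun t : ℝ => (1 - t) ^ p) (-1 * p * (1 - x) ^ (p - 1)) x :=
        ((hasDerivAt_id x).const_sub 1).rpow_const (Or.inr hp1)
      have h3 : HasDerivAt (fun t : ℝ => p * (p - 1) * t ^ 2) (p * (p - 1) * (2 * x)) x := by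
        simpa using (hasDerivAt_pow 2 x).const_mul (p * (p - 1))
      exact ((h1.add h2).sub h3).congr_deriv (by ring)
    · intro x hx
      rw [interior_Icc] at hx
      have := two_mul_le_rpow_sub_rpow (r := p - 1) (t := x) (by linarith) (by linarith)
        hx.1.le hx.2.le
      exact mul_nonneg (by linarith) (by linarith)
  have := hmono ⟨le_rfl, zero_le_one⟩ ⟨ht0, ht1⟩ ht0
  simp only [add_zero, sub_zero, Real.one_rpow] at this
  nlinarith

/-- The two-point hypercontractive inequality. -/
theorem two_point {ρ x y : ℝ} (hρ0 : 0 ≤ ρ) (hρ1 : ρ ≤ 1) (hx : 0 ≤ x) (hy : 0 ≤ y) :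
    (((1 + ρ) / 2 * x + (1 - ρ) / 2 * y) ^ 2 + ((1 + ρ) / 2 * y + (1 - ρ) / 2 * x) ^ 2) / 2 ≤
      ((x ^ (1 + ρ ^ 2) + y ^ (1 + ρ ^ 2)) / 2) ^ (2 / (1 + ρ ^ 2)) := by
  wlog hxy : y ≤ x generalizing x y
  · have := this hy hx (by linarith)
    rw [add_comm (x ^ (1 + ρ ^ 2)), add_comm (((1 + ρ) / 2 * x + (1 - ρ) / 2 * y) ^ 2)]
    exact this
  set p := 1 + ρ ^ 2 with hp
  have hp1 : 1 ≤ p := by nlinarith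
  have hp2 : p ≤ 2 := by nlinarith
  have hp0 : 0 < p := by linarith
  rcases hx.eq_or_lt with rfl | hx
  · obtain rfl : y = 0 := le_antisymm hxy hy
    simp only [mul_zero, add_zero]
    norm_num
    positivity
  -- By homogeneity only `x = s(1+t)`, `y = s(1-t)` matter. Noise replaces `t` by `ρt`, so the left
  -- side is `s²(1 + ρ²t²)`, and `ρ² = p - 1`.
  set s := (x + y) / 2 with hs
  set t := (x - y) / (x + y) with ht
  have hs0 : 0 < s := by positivity
  have ht0 : 0 ≤ t := div_nonneg (by linarith) (by linarith)
  have ht1 : t ≤ 1 := (div_le_one (by positivity)).2 (by linarith)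
  have hx' : x = s * (1 + t) := by
    rw [hs, ht]; field_simp; ring
  have hy' : y = s * (1 - t) := by
    rw [hs, ht]; field_simp; ring
  have hl : (((1 + ρ) / 2 * x + (1 - ρ) / 2 * y) ^ 2 + ((1 + ρ) / 2 * y + (1 - ρ) / 2 * x) ^ 2) / 2
      = s ^ 2 * (1 + (p - 1) * t ^ 2) := by
    rw [hx', hy', hp]; ring
  have hr : ((x ^ p + y ^ p) / 2) ^ (2 / p)
      = s ^ 2 * (((1 + t) ^ p + (1 - t) ^ p) / 2) ^ (2 / p) := by
    rw [hx', hy', Real.mul_rpow hs0.le (by linarith), Real.mul_rpow hs0.le (by linarith),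
      ← mul_add, mul_div_assoc, Real.mul_rpow (by positivity), ← Real.rpow_mul hs0.le,
      mul_div_cancel₀ _ hp0.ne', Real.rpow_two]
    have h1 : 0 ≤ (1 + t) ^ p := Real.rpow_nonneg (by linarith) _
    have h2 : 0 ≤ (1 - t) ^ p := Real.rpow_nonneg (by linarith) _
    positivity
  rw [hl, hr]
  gcongr
  have h0 : 0 ≤ (p - 1) * t ^ 2 := mul_nonneg (by linarith) (sq_nonneg t)
  -- Bernoulli's inequality for the exponent `p/2 ≤ 1`, then the second-order lower bound for the
  -- mean of `(1 ± t)^p`.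
  have h1 : (1 + (p - 1) * t ^ 2) ^ (p / 2) ≤ ((1 + t) ^ p + (1 - t) ^ p) / 2 :=
    (rpow_one_add_le_one_add_mul_self (by linarith) (by linarith) (by linarith)).trans
      (one_add_mul_sq_le_rpow_add_rpow hp1 hp2 ht0 ht1)
  calc 1 + (p - 1) * t ^ 2 = ((1 + (p - 1) * t ^ 2) ^ (p / 2)) ^ (2 / p) := by
        rw [← Real.rpow_mul (by linarith), div_mul_div_cancel₀ (by norm_num), div_self hp0.ne',
          Real.rpow_one]
    _ ≤ _ := Real.rpow_le_rpow (by positivity) h1 (by positivity)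

/-- The noise operator `f ↦ E[f(N_ρ(·))]`. -/
noncomputable def noiseOp (ρ : ℝ) : (n : ℕ) → (Word n → ℝ) → Word n → ℝ
  | 0, f, c => f c
  | n + 1, f, c =>
    (1 + ρ) / 2 * noiseOp ρ n (fun x => f (Fin.cons (c 0) x)) (Fin.tail c) +
      (1 - ρ) / 2 * noiseOp ρ n (fun x => f (Fin.cons (!c 0) x)) (Fin.tail c)

theorem noiseOp_nonneg {ρ : ℝ} (hρ0 : 0 ≤ ρ) (hρ1 : ρ ≤ 1) {n : ℕ} {f : Word n → ℝ}
    (hf : ∀ x, 0 ≤ f x) (c : Word n) : 0 ≤ noiseOp ρ n f c := by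
  induction n with
  | zero => exact hf c
  | succ n ih =>
    have h1 := ih (f := fun x => f (Fin.cons (c 0) x)) (fun x => hf _) (Fin.tail c)
    have h2 := ih (f := fun x => f (Fin.cons (!c 0) x)) (fun x => hf _) (Fin.tail c)
    exact add_nonneg (mul_nonneg (by linarith) h1) (mul_nonneg (by linarith) h2)

theorem sum_word_succ {n : ℕ} {M : Type*} [AddCommMonoid M] (f : Word (n + 1) → M) :
    ∑ c, f c = (∑ x : Word n, f (Fin.cons true x)) + ∑ x : Word n, f (Fin.cons false x) := by
  rw [← (Fin.consEquiv fun _ : Fin (n + 1) => Bool).sum_comp, Fintype.sum_prod_type,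
    Fintype.sum_bool]
  rfl

/-- Hypercontractivity (Bonami): `‖T_ρ f‖₂ ≤ ‖f‖_{1+ρ²}` for nonnegative `f` on the cube. -/
theorem hypercontractive {ρ : ℝ} (hρ0 : 0 ≤ ρ) (hρ1 : ρ ≤ 1) {n : ℕ} {f : Word n → ℝ}
    (hf : ∀ x, 0 ≤ f x) :
    (∑ c, noiseOp ρ n f c ^ 2) / 2 ^ n ≤
      ((∑ x, f x ^ (1 + ρ ^ 2)) / 2 ^ n) ^ (2 / (1 + ρ ^ 2)) := by
  have hp0 : 0 < 1 + ρ ^ 2 := by positivity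
  induction n with
  | zero =>
    simp only [noiseOp, pow_zero, div_one, Fintype.sum_unique]
    rw [← Real.rpow_mul (hf _), mul_div_cancel₀ _ hp0.ne', Real.rpow_two]
  | succ n ih =>
    have ih1 := ih (f := fun x => f (Fin.cons true x)) fun x => hf _
    have ih0 := ih (f := fun x => f (Fin.cons false x)) fun x => hf _
    rw [sum_word_succ, sum_word_succ]
    simp only [noiseOp, Fin.cons_zero, Fin.tail_cons, Bool.not_true, Bool.not_false]
    set A := noiseOp ρ n fun x => f (Fin.cons true x)
    set B := noiseOp ρ n fun x => f (Fin.cons false x)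
    have hA : ∀ x, 0 ≤ A x := noiseOp_nonneg hρ0 hρ1 fun x => hf _
    have hB : ∀ x, 0 ≤ B x := noiseOp_nonneg hρ0 hρ1 fun x => hf _
    set a := (∑ x : Word n, f (Fin.cons true x) ^ (1 + ρ ^ 2)) / 2 ^ n with ha
    set b := (∑ x : Word n, f (Fin.cons false x) ^ (1 + ρ ^ 2)) / 2 ^ n with hb
    have ha0 : 0 ≤ a := div_nonneg (Finset.sum_nonneg fun x _ => Real.rpow_nonneg (hf _) _)
      (by positivity)
    have hb0 : 0 ≤ b := div_nonneg (Finset.sum_nonneg fun x _ => Real.rpow_nonneg (hf _) _)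
      (by positivity)
    set p := 1 + ρ ^ 2 with hp
    set r := 2 / p with hr
    have hr0 : 0 < r := by positivity
    have hr1 : 1 ≤ r := by
      rw [hr, le_div_iff₀ hp0]; nlinarith
    -- The induction hypothesis, rephrased as a bound on the `ℓ^r` norm of `g^p` with `r = 2/p ≥ 1`,
    -- which is the form that Minkowski's inequality takes.
    have key : ∀ {g : Word n → ℝ} {e : ℝ}, (∀ x, 0 ≤ g x) → 0 ≤ e →
        (∑ x, g x ^ 2) / 2 ^ n ≤ e ^ r →
        (∑ x, (g x ^ p) ^ r) ^ (1 / r) ≤ ((2 : ℝ) ^ n) ^ (1 / r) * e := by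
      intro g e hg he h
      have h1 : ∀ x, (g x ^ p) ^ r = g x ^ 2 := fun x => by
        rw [← Real.rpow_mul (hg x), hr, mul_div_cancel₀ _ hp0.ne', Real.rpow_two]
      simp only [h1]
      rw [div_le_iff₀ (by positivity)] at h
      calc (∑ x, g x ^ 2) ^ (1 / r) ≤ (e ^ r * 2 ^ n) ^ (1 / r) :=
            Real.rpow_le_rpow (Finset.sum_nonneg fun x _ => sq_nonneg _) h (by positivity)
        _ = _ := by
          rw [Real.mul_rpow (by positivity) (by positivity), ← Real.rpow_mul he,
            mul_one_div_cancel hr0.ne', Real.rpow_one, mul_comm]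
    have hmink := Real.Lp_add_le_of_nonneg (s := Finset.univ) (f := fun x => A x ^ p)
      (g := fun x => B x ^ p) hr1 (fun x _ => Real.rpow_nonneg (hA x) _)
      (fun x _ => Real.rpow_nonneg (hB x) _)
    have hmink2 := hmink.trans (add_le_add (key hA ha0 ih1) (key hB hb0 ih0))
    rw [← mul_add] at hmink2
    have hS0 : 0 ≤ ∑ x, (A x ^ p + B x ^ p) ^ r := Finset.sum_nonneg fun x _ =>
      Real.rpow_nonneg (add_nonneg (Real.rpow_nonneg (hA x) _) (Real.rpow_nonneg (hB x) _)) _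
    have hmink3 : ∑ x, (A x ^ p + B x ^ p) ^ r ≤ 2 ^ n * (a + b) ^ r := by
      have := Real.rpow_le_rpow (Real.rpow_nonneg hS0 _) hmink2 hr0.le
      rwa [← Real.rpow_mul hS0, one_div_mul_cancel hr0.ne', Real.rpow_one,
        Real.mul_rpow (by positivity) (by positivity), ← Real.rpow_mul (by positivity),
        one_div_mul_cancel hr0.ne', Real.rpow_one] at this
    -- The two-point inequality treats the first coordinate for each fixed remainder `x`; Minkowski
    -- has already combined the two halves of the cube.
    have htwo : ∀ x, (((1 + ρ) / 2 * A x + (1 - ρ) / 2 * B x) ^ 2 +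
        ((1 + ρ) / 2 * B x + (1 - ρ) / 2 * A x) ^ 2) ≤ 2 * ((A x ^ p + B x ^ p) ^ r / 2 ^ r) := by
      intro x
      have := two_point hρ0 hρ1 (hA x) (hB x)
      rw [Real.div_rpow (add_nonneg (Real.rpow_nonneg (hA x) _) (Real.rpow_nonneg (hB x) _))
        (by norm_num)] at this
      linarith
    rw [← Finset.sum_add_distrib]
    calc _ ≤ (∑ x, 2 * ((A x ^ p + B x ^ p) ^ r / 2 ^ r)) / 2 ^ (n + 1) := by
          gcongr with x
          exact htwo x
      _ = (∑ x, (A x ^ p + B x ^ p) ^ r) / 2 ^ n / 2 ^ r := by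
          rw [← Finset.mul_sum, ← Finset.sum_div, pow_succ]
          field_simp
      _ ≤ (2 ^ n * (a + b) ^ r) / 2 ^ n / 2 ^ r := by gcongr
      _ = ((a + b) / 2) ^ r := by
          rw [Real.div_rpow (by positivity) (by norm_num)]
          field_simp
      _ = _ := by
          congr 1
          rw [ha, hb, pow_succ]
          field_simp

theorem flipBit_true (ρ : unitInterval) : flipBit ρ true = ENNReal.ofReal ((1 - (ρ : ℝ)) / 2) := by
  simp [flipBit]

theorem flipBit_false (ρ : unitInterval) :
    flipBit ρ false = ENNReal.ofReal ((1 + (ρ : ℝ)) / 2) := by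
  simp [flipBit]

/-- The channel flips coordinates independently, so peeling off the first one gives the recursion of
`noiseOp`. Nonnegativity makes `ENNReal.ofReal` additive. -/
theorem ex_noise (ρ : unitInterval) {n : ℕ} (c : Word n) {f : Word n → ℝ} (hf : ∀ x, 0 ≤ f x) :
    (ex (noise ρ c) fun x => ENNReal.ofReal (f x)) = ENNReal.ofReal (noiseOp ρ n f c) := by
  have h0 := ρ.2.1
  have h1 := ρ.2.2
  induction n with
  | zero =>
    rw [noise, ex_map, ex_iid_zero, noiseOp]
    congr 2
    exact Subsingleton.elim _ _
  | succ n ih =>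
    rw [noise, ex_map, ex_iid_succ, ex_eq_sum, Fintype.sum_bool, flipBit_true, flipBit_false]
    have hcons : ∀ (b : Bool) (v : Word n), (fun i => xor (c i) ((Fin.cons b v : Word (n + 1)) i))
        = (Fin.cons (xor (c 0) b) fun i => xor (Fin.tail c i) (v i) : Word (n + 1)) := by
      intro b v
      ext i
      refine Fin.cases ?_ (fun j => ?_) i <;> simp [Fin.tail]
    simp only [hcons, Bool.xor_true, Bool.xor_false]
    have key : ∀ b : Bool, (ex (iid (flipBit ρ) n) fun v =>
        ENNReal.ofReal (f (Fin.cons b fun i => xor (Fin.tail c i) (v i))))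
        = ENNReal.ofReal (noiseOp ρ n (fun x => f (Fin.cons b x)) (Fin.tail c)) := by
      intro b
      rw [← ih (Fin.tail c) (f := fun x => f (Fin.cons b x)) fun x => hf _, noise, ex_map]
    rw [key, key, noiseOp, add_comm, ENNReal.ofReal_add, ENNReal.ofReal_mul (by linarith),
      ENNReal.ofReal_mul (by linarith)]
    · exact mul_nonneg (by linarith) (noiseOp_nonneg h0 h1 (fun x => hf _) _)
    · exact mul_nonneg (by linarith) (noiseOp_nonneg h0 h1 (fun x => hf _) _)


theorem noiseOp_le_one {ρ : ℝ} (hρ0 : 0 ≤ ρ) (hρ1 : ρ ≤ 1) {n : ℕ} {f : Word n → ℝ}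
    (hf : ∀ x, f x ≤ 1) (c : Word n) : noiseOp ρ n f c ≤ 1 := by
  induction n with
  | zero => exact hf c
  | succ n ih =>
    have h1 := ih (f := fun x => f (Fin.cons (c 0) x)) (fun x => hf _) (Fin.tail c)
    have h2 := ih (f := fun x => f (Fin.cons (!c 0) x)) (fun x => hf _) (Fin.tail c)
    rw [noiseOp]
    nlinarith

/-- Two correlated randomized choices of at most `Q` points each, the first made at a uniformly
random word and the second at a noisy copy of it, have a common point only with small probability
if the second choice hits each point with probability at most `τ`. -/
theorem light_collision {ρ : ℝ} (hρ0 : 0 ≤ ρ) (hρ1 : ρ ≤ 1) {n : ℕ} {ι : Type} [Fintype ι]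
    {Q τ : ℝ} (hτ : 0 < τ) {G f : ι → Word n → ℝ}
    (hG0 : ∀ y c, 0 ≤ G y c) (hG1 : ∀ y c, G y c ≤ 1) (hGQ : ∀ c, ∑ y, G y c ≤ Q)
    (hf0 : ∀ y c, 0 ≤ f y c) (hf1 : ∀ y c, f y c ≤ 1) (hfQ : ∀ c, ∑ y, f y c ≤ Q)
    (hfτ : ∀ y, (∑ x, f y x) / 2 ^ n ≤ τ) :
    (∑ c, ∑ y, G y c * noiseOp ρ n (f y) c) / 2 ^ n ≤
      Q * τ ^ ((1 / 2 : ℝ) * ((1 - ρ ^ 2) / (1 + ρ ^ 2))) := by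
  have hp0 : 0 < 1 + ρ ^ 2 := by positivity
  set α := (1 - ρ ^ 2) / (1 + ρ ^ 2) with hα
  have hα0 : 0 ≤ α := div_nonneg (by nlinarith) hp0.le
  have hQ0 : 0 ≤ Q := (Finset.sum_nonneg fun y _ => hG0 y default).trans (hGQ default)
  have hcard : ∑ _c : Word n, Q = 2 ^ n * Q := by simp
  have h1 : ∑ z : Word n × ι, G z.2 z.1 ^ 2 ≤ 2 ^ n * Q := by
    rw [Fintype.sum_prod_type, ← hcard]
    refine Finset.sum_le_sum fun c _ => le_trans (Finset.sum_le_sum fun y _ => ?_) (hGQ c)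
    nlinarith [hG0 y c, hG1 y c]
  -- Hypercontractivity enters here: without it the smallness of the means of `f y` would not reach
  -- the second moment.
  have h2 : ∑ z : Word n × ι, noiseOp ρ n (f z.2) z.1 ^ 2 ≤ 2 ^ n * (Q * τ ^ α) := by
    rw [Fintype.sum_prod_type_right]
    have hy : ∀ y, ∑ c, noiseOp ρ n (f y) c ^ 2 ≤ (∑ x, f y x) * τ ^ α := by
      intro y
      have hm0 : 0 ≤ (∑ x, f y x) / 2 ^ n :=
        div_nonneg (Finset.sum_nonneg fun x _ => hf0 y x) (by positivity)
      have := hypercontractive hρ0 hρ1 (hf0 y)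
      have h3 : ((∑ x, f y x ^ (1 + ρ ^ 2)) / 2 ^ n) ^ (2 / (1 + ρ ^ 2)) ≤
          ((∑ x, f y x) / 2 ^ n) * τ ^ α := by
        calc _ ≤ ((∑ x, f y x) / 2 ^ n) ^ (2 / (1 + ρ ^ 2)) := by
              refine Real.rpow_le_rpow (div_nonneg (Finset.sum_nonneg fun x _ =>
                Real.rpow_nonneg (hf0 y x) _) (by positivity)) ?_ (by positivity)
              gcongr with x
              refine (Real.rpow_le_rpow_of_exponent_ge_of_imp (hf0 y x) (hf1 y x)
                (by nlinarith : (1 : ℝ) ≤ 1 + ρ ^ 2) ?_).trans (Real.rpow_one _).le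
              intro _ h
              linarith
          -- Since `2/(1+ρ²) = 1 + α`, one factor of the mean remains to be summed over `y`, and the
          -- rest is at most `τ^α`.
          _ = ((∑ x, f y x) / 2 ^ n) ^ (1 + α) := by
              congr 1
              rw [hα]
              field_simp
              ring
          _ = ((∑ x, f y x) / 2 ^ n) * ((∑ x, f y x) / 2 ^ n) ^ α := by
              rw [Real.rpow_add_of_nonneg hm0 zero_le_one hα0, Real.rpow_one]
          _ ≤ _ := by
              gcongr
              exact hfτ y
      have h4 := this.trans h3
      rw [div_mul_eq_mul_div] at h4
      exact (div_le_div_iff_of_pos_right (by positivity)).1 h4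
    refine (Finset.sum_le_sum fun y _ => hy y).trans ?_
    rw [← Finset.sum_mul, Finset.sum_comm, ← mul_assoc]
    gcongr
    rw [← hcard]
    exact Finset.sum_le_sum fun c _ => hfQ c
  -- Cauchy-Schwarz over pairs (word, point); its square root is the source of the factor `1/2` in
  -- the exponent of `τ`.
  have h3 := Real.sum_mul_le_sqrt_mul_sqrt Finset.univ (fun z : Word n × ι => G z.2 z.1)
    (fun z => noiseOp ρ n (f z.2) z.1)
  rw [Fintype.sum_prod_type] at h3
  rw [div_le_iff₀ (by positivity)]
  refine h3.trans ?_
  rw [← Real.sqrt_mul (Finset.sum_nonneg fun z _ => sq_nonneg _)]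
  refine Real.sqrt_le_iff.2 ⟨by positivity, ?_⟩
  calc _ ≤ (2 ^ n * Q) * (2 ^ n * (Q * τ ^ α)) := by
        gcongr
    _ = (Q * τ ^ (1 / 2 * α) * 2 ^ n) ^ 2 := by
        have : τ ^ α = (τ ^ (1 / 2 * α)) ^ 2 := by
          rw [← Real.rpow_natCast, ← Real.rpow_mul hτ.le]
          congr 1
          push_cast
          ring
        rw [this]
        ring

/-- The version of `light_collision` for a word of arbitrary distribution `D`. -/
theorem light_collision_of_distribution {ρ : ℝ} (hρ0 : 0 ≤ ρ) (hρ1 : ρ ≤ 1) {n : ℕ} {ι : Type}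
    [Fintype ι] {Q τ : ℝ} (hτ : 0 < τ) {G f : ι → Word n → ℝ} {D : Word n → ℝ}
    (hG0 : ∀ y c, 0 ≤ G y c) (hG1 : ∀ y c, G y c ≤ 1) (hGQ : ∀ c, ∑ y, G y c ≤ Q)
    (hf0 : ∀ y c, 0 ≤ f y c) (hf1 : ∀ y c, f y c ≤ 1) (hfQ : ∀ c, ∑ y, f y c ≤ Q)
    (hfτ : ∀ y, (∑ x, f y x) / 2 ^ n ≤ τ) :
    ∑ c, ∑ y, D c * G y c * noiseOp ρ n (f y) c ≤
      Q * τ ^ ((1 / 2 : ℝ) * ((1 - ρ ^ 2) / (1 + ρ ^ 2))) +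
        Q * ∑ c, max (D c - (2 ^ n)⁻¹) 0 := by
  refine le_trans ?_ (add_le_add (light_collision hρ0 hρ1 hτ hG0 hG1 hGQ hf0 hf1 hfQ hfτ)
    (le_refl (Q * ∑ c, max (D c - (2 ^ n)⁻¹) 0)))
  rw [Finset.sum_div, Finset.mul_sum, ← Finset.sum_add_distrib]
  refine Finset.sum_le_sum fun c _ => ?_
  have hT0 : ∀ y, 0 ≤ noiseOp ρ n (f y) c := fun y => noiseOp_nonneg hρ0 hρ1 (hf0 y) c
  have hs0 : 0 ≤ ∑ y, G y c * noiseOp ρ n (f y) c :=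
    Finset.sum_nonneg fun y _ => mul_nonneg (hG0 y c) (hT0 y)
  have hsQ : ∑ y, G y c * noiseOp ρ n (f y) c ≤ Q := by
    refine le_trans (Finset.sum_le_sum fun y _ => ?_) (hGQ c)
    exact mul_le_of_le_one_right (hG0 y c) (noiseOp_le_one hρ0 hρ1 (hf1 y) c)
  have : ∑ y, D c * G y c * noiseOp ρ n (f y) c = D c * ∑ y, G y c * noiseOp ρ n (f y) c := by
    rw [Finset.mul_sum]
    exact Finset.sum_congr rfl fun y _ => by ring
  rw [this, div_eq_inv_mul]
  -- The excess of `D` over uniform is charged with the trivial bound `Q` on the inner sum.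
  have h1 : D c ≤ (2 ^ n)⁻¹ + max (D c - (2 ^ n)⁻¹) 0 := by
    linarith [le_max_left (D c - (2 ^ n)⁻¹) 0]
  have h2 : 0 ≤ max (D c - (2 ^ n : ℝ)⁻¹) 0 := le_max_right _ _
  nlinarith [mul_le_mul_of_nonneg_right h1 hs0, mul_le_mul_of_nonneg_left hsQ h2]

/-! ### Relative entropy -/

section entropy

variable {α : Type} [Fintype α]

/-- Relative entropy with respect to the uniform distribution is small for distributions close to
uniform in total variation. -/
theorem sum_mul_log_le {P : α → ℝ} {M η : ℝ} (hM : 1 ≤ M) (hP0 : ∀ a, 0 ≤ P a)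
    (hP1 : ∀ a, P a ≤ 1) (hη : ∑ a, max (P a - M⁻¹) 0 ≤ η) :
    ∑ a, P a * Real.log (M * P a) ≤ η * (Real.log M + 1) := by
  have hM0 : 0 < M := by linarith
  have hlM : 0 ≤ Real.log M := Real.log_nonneg hM
  refine le_trans ?_ (mul_le_mul_of_nonneg_right hη (by linarith))
  rw [Finset.sum_mul]
  refine Finset.sum_le_sum fun a _ => ?_
  rcases le_total (P a) M⁻¹ with h | h
  · rw [max_eq_right (by linarith), zero_mul]
    refine mul_nonpos_of_nonneg_of_nonpos (hP0 a) (Real.log_nonpos ?_ ?_)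
    · exact mul_nonneg hM0.le (hP0 a)
    · calc M * P a ≤ M * M⁻¹ := by gcongr
        _ = 1 := mul_inv_cancel₀ hM0.ne'
  -- Split `P a = (P a - M⁻¹) + M⁻¹`. The logarithm is bounded by `log M` on the first part and by
  -- `M * P a - 1` on the second.
  · rw [max_eq_left (by linarith)]
    have ha : 0 < P a := lt_of_lt_of_le (by positivity) h
    have h1 : Real.log (M * P a) ≤ Real.log M := by
      refine Real.log_le_log (by positivity) ?_
      nlinarith [hP1 a]
    have h2 : Real.log (M * P a) ≤ M * P a - 1 := Real.log_le_sub_one_of_pos (by positivity)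
    have h3 : M⁻¹ * Real.log (M * P a) ≤ P a - M⁻¹ := by
      calc M⁻¹ * Real.log (M * P a) ≤ M⁻¹ * (M * P a - 1) := by gcongr
        _ = P a - M⁻¹ := by field_simp
    nlinarith [mul_le_mul_of_nonneg_left h1 (by linarith : 0 ≤ P a - M⁻¹)]

/-- A form of Pinsker's inequality. -/
theorem sq_sum_max_le {D : α → ℝ} {M : ℝ} (hM : M = Fintype.card α) (hD0 : ∀ a, 0 ≤ D a)
    (hD1 : ∑ a, D a = 1) :
    (∑ a, max (D a - M⁻¹) 0) ^ 2 ≤ ∑ a, D a * Real.log (M * D a) := by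
  have hne : Nonempty α := by
    by_contra h
    rw [not_nonempty_iff] at h
    simp at hD1
  have hM0 : 0 < M := by
    rw [hM]; exact_mod_cast Fintype.card_pos
  have hMs : ∑ _a : α, M⁻¹ = 1 := by
    rw [Finset.sum_const, Finset.card_univ, nsmul_eq_mul, ← hM, mul_inv_cancel₀ hM0.ne']
  set s : ℝ := √(M⁻¹) with hs
  have hs2 : s ^ 2 = M⁻¹ := Real.sq_sqrt (by positivity)
  have hs0 : 0 < s := Real.sqrt_pos.2 (by positivity)
  have hd2 : ∀ a, √(D a) ^ 2 = D a := fun a => Real.sq_sqrt (hD0 a)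
  -- Total variation is half the `ℓ¹` distance. Factoring `D a - s²` as a difference of squares
  -- prepares Cauchy-Schwarz and a comparison with the Hellinger distance.
  have habs : ∑ a, max (D a - M⁻¹) 0 = 1 / 2 * ∑ a, |√(D a) - s| * |√(D a) + s| := by
    have h0 : ∑ a, (D a - M⁻¹) = 0 := by rw [Finset.sum_sub_distrib, hMs, hD1, sub_self]
    have h1 : ∀ a, max (D a - M⁻¹) 0 =
        1 / 2 * (|√(D a) - s| * |√(D a) + s|) + 1 / 2 * (D a - M⁻¹) := by
      intro a
      rw [← abs_mul, ← mul_add, show (√(D a) - s) * (√(D a) + s) = D a - M⁻¹ by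
        rw [← hs2]; nlinarith [hd2 a]]
      rcases le_total (D a - M⁻¹) 0 with h | h
      · rw [max_eq_right h, abs_of_nonpos h]; ring
      · rw [max_eq_left h, abs_of_nonneg h]; ring
    simp only [h1]
    rw [Finset.sum_add_distrib, ← Finset.mul_sum, ← Finset.mul_sum, h0]
    ring
  have hcs := Finset.sum_mul_sq_le_sq_mul_sq Finset.univ (fun a => |√(D a) - s|)
    (fun a => |√(D a) + s|)
  simp only [sq_abs] at hcs
  have hplus : ∑ a, (√(D a) + s) ^ 2 ≤ 4 := by
    calc ∑ a, (√(D a) + s) ^ 2 ≤ ∑ a, (2 * D a + 2 * M⁻¹) := by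
          refine Finset.sum_le_sum fun a _ => ?_
          rw [← hs2, ← hd2 a]
          simp only [hd2]
          nlinarith [sq_nonneg (√(D a) - s), hd2 a]
      _ = 4 := by
          rw [Finset.sum_add_distrib, ← Finset.mul_sum, ← Finset.mul_sum, hMs, hD1]
          norm_num
  -- The squared Hellinger distance is at most the relative entropy, by `log u ≤ u - 1` at `u =
  -- s/√(D a)`.
  have hminus : ∑ a, (√(D a) - s) ^ 2 ≤ ∑ a, D a * Real.log (M * D a) := by
    have h1 : ∑ a, (√(D a) - s) ^ 2 = ∑ a, (2 * D a - 2 * (√(D a) * s)) := by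
      have : ∑ a, (√(D a) - s) ^ 2 = ∑ a, (D a - 2 * (√(D a) * s)) + ∑ _a : α, M⁻¹ := by
        rw [← Finset.sum_add_distrib]
        refine Finset.sum_congr rfl fun a _ => ?_
        rw [← hs2, sub_sq, hd2]
        ring
      rw [this, hMs, ← hD1, ← Finset.sum_add_distrib]
      exact Finset.sum_congr rfl fun a _ => by ring
    rw [h1]
    refine Finset.sum_le_sum fun a _ => ?_
    rcases (hD0 a).eq_or_lt with h | h
    · rw [← h]; simp
    · have hd : 0 < √(D a) := Real.sqrt_pos.2 h
      have h2 := Real.log_le_sub_one_of_pos (div_pos hs0 hd)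
      have h3 : Real.log (s / √(D a)) = -(1 / 2) * Real.log (M * D a) := by
        have : s / √(D a) = √((M * D a)⁻¹) := by
          rw [hs, ← Real.sqrt_div (by positivity), mul_inv, div_eq_mul_inv]
        rw [this, Real.log_sqrt (by positivity), Real.log_inv]
        ring
      have h4 : Real.log (M * D a) ≥ 2 - 2 * (s / √(D a)) := by linarith
      have h5 : D a * (s / √(D a)) = √(D a) * s := by
        nth_rewrite 1 [← hd2 a]
        field_simp
      nlinarith [mul_le_mul_of_nonneg_left h4 h.le]
  rw [habs, mul_pow]
  have h0 : 0 ≤ ∑ a, (√(D a) - s) ^ 2 := Finset.sum_nonneg fun a _ => sq_nonneg _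
  have h4 : 0 ≤ ∑ a, (√(D a) + s) ^ 2 := Finset.sum_nonneg fun a _ => sq_nonneg _
  nlinarith [mul_le_mul_of_nonneg_left hplus h0]

/-- If `m` letters are close to uniform and a key from a set `s` makes them depend on it only
through marginals `D k`, then these marginals are close to uniform on average. -/
theorem average_entropy_le {κ : Type} {m : ℕ} (s : Finset κ) {w : κ → ℝ} (hw0 : ∀ k, 0 ≤ w k)
    (hw1 : ∑ k ∈ s, w k = 1) {W : κ → (Fin m → α) → ℝ} (hW0 : ∀ k c, 0 ≤ W k c)
    (hW1 : ∀ k, ∑ c, W k c = 1) {D : κ → α → ℝ} (hD0 : ∀ k a, 0 ≤ D k a) (hD1 : ∀ k, ∑ a, D k a = 1)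
    (hWD : ∀ k i (φ : α → ℝ), ∑ c, W k c * φ (c i) = ∑ a, D k a * φ a)
    {P : (Fin m → α) → ℝ} (hP : ∀ c, P c = ∑ k ∈ s, w k * W k c) {M : ℝ}
    (hM : 0 < M) :
    m * ∑ k ∈ s, w k * ∑ a, D k a * Real.log (M * D k a) ≤
      Real.log s.card + ∑ c, P c * Real.log (M ^ m * P c) := by
  have hs : s.Nonempty := by
    by_contra h
    rw [Finset.not_nonempty_iff_eq_empty] at h
    simp [h] at hw1
  have hs0 : (0 : ℝ) < s.card := by exact_mod_cast hs.card_pos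
  -- A component of the mixture is dominated by the mixture. This is what limits the information in
  -- the key to `log s.card`.
  have hdom : ∀ k ∈ s, ∀ c, w k * W k c ≤ P c := fun k hk c => by
    rw [hP]
    exact Finset.single_le_sum (f := fun k => w k * W k c)
      (fun j _ => mul_nonneg (hw0 j) (hW0 j c)) hk
  have hpos : ∀ k c i, 0 < W k c → 0 < D k (c i) := by
    classical
    intro k c i h
    have h1 := hWD k i (fun a => if a = c i then 1 else 0)
    simp only [mul_ite, mul_one, mul_zero, Finset.sum_ite_eq', Finset.mem_univ, if_true] at h1
    rw [← h1]
    refine lt_of_lt_of_le h ?_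
    refine le_trans ?_ (Finset.single_le_sum (f := fun d : Fin m → α =>
      if d i = c i then W k d else 0) ?_ (Finset.mem_univ c))
    · simp
    · intro d _
      split_ifs
      exacts [hW0 k d, le_rfl]
  -- Gibbs' inequality termwise: `log u ≤ u - 1` for `u = ∏ D k (c i) / (P c * s.card)`, weighted by
  -- `w k * W k c`. Summed over `k` and `c` the right side vanishes. Only marginals of `W k` enter,
  -- so the letters need not be independent given `k`.
  have hpt : ∀ k ∈ s, ∀ c, w k * W k c * (∑ i, Real.log (M * D k (c i))) -
      w k * W k c * Real.log (M ^ m * P c) - w k * W k c * Real.log s.card ≤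
        (∏ i, D k (c i)) / s.card - w k * W k c := by
    intro k hk c
    have hprod0 : 0 ≤ ∏ i, D k (c i) := Finset.prod_nonneg fun i _ => hD0 k _
    rcases (mul_nonneg (hw0 k) (hW0 k c)).eq_or_lt with h | h
    · rw [← h]
      simp only [zero_mul, sub_zero]
      positivity
    · have hWpos : 0 < W k c := (hW0 k c).lt_of_ne (by rintro h0; rw [← h0] at h; simp at h)
      have hPpos : 0 < P c := h.trans_le (hdom k hk c)
      have hDpos : ∀ i, 0 < D k (c i) := fun i => hpos k c i hWpos
      have hprod : 0 < ∏ i, D k (c i) := Finset.prod_pos fun i _ => hDpos i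
      have hlog : (∑ i, Real.log (M * D k (c i))) - Real.log (M ^ m * P c) - Real.log s.card =
          Real.log ((∏ i, D k (c i)) / (P c * s.card)) := by
        rw [← Real.log_prod fun i _ => (mul_pos hM (hDpos i)).ne', Finset.prod_mul_distrib,
          Finset.prod_const, Finset.card_univ, Fintype.card_fin, Real.log_mul (by positivity)
          hprod.ne', Real.log_mul (by positivity) hPpos.ne', Real.log_div hprod.ne'
          (by positivity), Real.log_mul hPpos.ne' hs0.ne']
        ring
      have h1 := Real.log_le_sub_one_of_pos
        (div_pos hprod (mul_pos hPpos hs0))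
      rw [← hlog] at h1
      have h2 := mul_le_mul_of_nonneg_left h1 h.le
      have h3 : w k * W k c * ((∏ i, D k (c i)) / (P c * s.card)) ≤ (∏ i, D k (c i)) / s.card := by
        calc _ ≤ P c * ((∏ i, D k (c i)) / (P c * s.card)) := by
              gcongr
              exact hdom k hk c
          _ = _ := by field_simp
      linarith
  have hsum := Finset.sum_le_sum fun k hk => Finset.sum_le_sum fun c (_ : c ∈ Finset.univ) =>
    hpt k hk c
  simp only [Finset.sum_sub_distrib] at hsum
  have e1 : ∑ k ∈ s, ∑ c, w k * W k c * (∑ i, Real.log (M * D k (c i))) =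
      m * ∑ k ∈ s, w k * ∑ a, D k a * Real.log (M * D k a) := by
    rw [Finset.mul_sum]
    refine Finset.sum_congr rfl fun k _ => ?_
    simp only [mul_assoc, ← Finset.mul_sum]
    rw [mul_left_comm]
    congr 1
    rw [Finset.sum_congr rfl fun c _ => Finset.mul_sum _ _ _, Finset.sum_comm]
    simp only [hWD k _ fun a => Real.log (M * D k a)]
    simp
  have e2 : ∑ k ∈ s, ∑ c, w k * W k c * Real.log (M ^ m * P c) =
      ∑ c, P c * Real.log (M ^ m * P c) := by
    rw [Finset.sum_comm]
    exact Finset.sum_congr rfl fun c _ => by rw [← Finset.sum_mul, ← hP]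
  have e3 : ∑ k ∈ s, ∑ c, w k * W k c = 1 := by
    simp only [← Finset.mul_sum, hW1, mul_one, hw1]
  have e4 : ∑ k ∈ s, ∑ c, w k * W k c * Real.log s.card = Real.log s.card := by
    simp only [← Finset.sum_mul, e3, one_mul]
  have e5 : ∑ k ∈ s, ∑ c : Fin m → α, (∏ i, D k (c i)) / (s.card : ℝ) = 1 := by
    have : ∀ k, ∑ c : Fin m → α, ∏ i, D k (c i) = 1 := by
      classical
      intro k
      rw [← Fintype.piFinset_univ, ← Finset.prod_univ_sum]
      simp [hD1]
    simp only [← Finset.sum_div, this]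
    simp [hs0.ne']
  rw [e1, e2, e3, e4, e5] at hsum
  linarith

/-- Letters whose marginals given a key from a set `s` are `D k` are close to uniform on average if
`m` of them are close to uniform without the key. -/
theorem sq_average_distance_le {κ : Type} {m : ℕ} (hm : 0 < m) (s : Finset κ) {w : κ → ℝ}
    (hw0 : ∀ k, 0 ≤ w k) (hw1 : ∑ k ∈ s, w k = 1) {W : κ → (Fin m → α) → ℝ}
    (hW0 : ∀ k c, 0 ≤ W k c) (hW1 : ∀ k, ∑ c, W k c = 1) {D : κ → α → ℝ} (hD0 : ∀ k a, 0 ≤ D k a)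
    (hD1 : ∀ k, ∑ a, D k a = 1)
    (hWD : ∀ k i (φ : α → ℝ), ∑ c, W k c * φ (c i) = ∑ a, D k a * φ a)
    {P : (Fin m → α) → ℝ} (hP : ∀ c, P c = ∑ k ∈ s, w k * W k c) {M η : ℝ}
    (hM : M = Fintype.card α) (hη : ∑ c, max (P c - (M ^ m)⁻¹) 0 ≤ η) :
    (∑ k ∈ s, w k * ∑ a, max (D k a - M⁻¹) 0) ^ 2 ≤
      (Real.log s.card + η * (m * Real.log M + 1)) / m := by
  have hs : s.Nonempty := by
    by_contra h
    rw [Finset.not_nonempty_iff_eq_empty] at h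
    simp [h] at hw1
  obtain ⟨k0, -⟩ := hs
  have hne : Nonempty α := by
    by_contra h
    rw [not_nonempty_iff] at h
    simpa using hD1 k0
  have hM1 : 1 ≤ M := by
    rw [hM]; exact_mod_cast Fintype.card_pos
  have hP0 : ∀ c, 0 ≤ P c := fun c => by
    rw [hP]; exact Finset.sum_nonneg fun k _ => mul_nonneg (hw0 k) (hW0 k c)
  have hP1 : ∑ c, P c = 1 := by
    simp only [hP]
    rw [Finset.sum_comm]
    simp only [← Finset.mul_sum, hW1, mul_one, hw1]
  have h1 := average_entropy_le s hw0 hw1 hW0 hW1 hD0 hD1 hWD hP (by linarith : 0 < M)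
  have h2 := sum_mul_log_le (one_le_pow₀ hM1 : 1 ≤ M ^ m) hP0
    (fun c => hP1 ▸ Finset.single_le_sum (fun d _ => hP0 d) (Finset.mem_univ c)) hη
  rw [Real.log_pow] at h2
  rw [le_div_iff₀ (by exact_mod_cast hm)]
  -- Pinsker bounds the squared distance for each key, so the square is first moved inside the
  -- average.
  have hjensen : (∑ k ∈ s, w k * ∑ a, max (D k a - M⁻¹) 0) ^ 2 ≤
      ∑ k ∈ s, w k * (∑ a, max (D k a - M⁻¹) 0) ^ 2 := by
    simpa only [smul_eq_mul] using (convexOn_pow 2).map_sum_le (t := s) (w := w) (p := fun k => ∑ a, max (D k a - M⁻¹) 0)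
      (fun k _ => hw0 k) hw1 fun k _ => Set.mem_Ici.2 (Finset.sum_nonneg fun a _ => le_max_right _ _)
  have h3 : (∑ k ∈ s, w k * ∑ a, max (D k a - M⁻¹) 0) ^ 2 ≤
      ∑ k ∈ s, w k * ∑ a, D k a * Real.log (M * D k a) := by
    refine hjensen.trans (Finset.sum_le_sum fun k _ => ?_)
    exact mul_le_mul_of_nonneg_left (sq_sum_max_le hM (hD0 k) (hD1 k)) (hw0 k)
  have h4 := mul_le_mul_of_nonneg_left h3 (Nat.cast_nonneg (α := ℝ) m)
  linarith

end entropy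

/-! ### Resampling random oracles -/

section oracle

variable {lam : ℕ} {α : Type}

open Classical in
/-- The oracle that answers like `F` on `s` and like `G` elsewhere. -/
noncomputable def patch (s : Set (Word lam)) (F G : Oracle lam) : Oracle lam :=
  fun x => if x ∈ s then F x else G x

theorem patch_of_mem {s : Set (Word lam)} {x : Word lam} (h : x ∈ s) (F G : Oracle lam) :
    patch s F G x = F x := if_pos h

theorem patch_of_notMem {s : Set (Word lam)} {x : Word lam} (h : x ∉ s) (F G : Oracle lam) :
    patch s F G x = G x := if_neg h

theorem patch_patch (s : Set (Word lam)) (F G : Oracle lam) :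
    patch s (patch s F G) (patch s G F) = F := by
  ext x
  by_cases h : x ∈ s <;> simp [patch, h]

/-- Resampling a random oracle outside a set that is determined by the answers on it does not
change its distribution. -/
theorem ex_patch (D : Oracle lam → Set (Word lam))
    (hD : ∀ F F', (∀ x ∈ D F, F' x = F x) → D F' = D F) (ψ : Oracle lam → ℝ≥0∞) :
    (ex (PMF.uniformOfFintype (Oracle lam)) fun F =>
      ex (PMF.uniformOfFintype (Oracle lam)) fun G => ψ (patch (D F) F G)) =
    ex (PMF.uniformOfFintype (Oracle lam)) ψ := by
  have hD' : ∀ F G, D (patch (D F) F G) = D F := fun F G =>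
    hD _ _ fun x hx => patch_of_mem hx F G
  -- Exchange the answers of `F` and `G` outside `D F`. As this leaves `D F` unchanged, it is an
  -- involution and preserves the uniform measure on pairs.
  let σ : Oracle lam × Oracle lam → Oracle lam × Oracle lam := fun z =>
    (patch (D z.1) z.1 z.2, patch (D z.1) z.2 z.1)
  have hσ : Function.Involutive σ := by
    rintro ⟨F, G⟩
    simp only [σ, hD', patch_patch]
  have hswap : ∑ z : Oracle lam × Oracle lam, ψ (patch (D z.1) z.1 z.2) =
      ∑ z : Oracle lam × Oracle lam, ψ z.1 :=
    Equiv.sum_comp (hσ.toPerm σ) fun z : Oracle lam × Oracle lam => ψ z.1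
  have hconst : ex (PMF.uniformOfFintype (Oracle lam)) ψ =
      ex (PMF.uniformOfFintype (Oracle lam)) fun F =>
        ex (PMF.uniformOfFintype (Oracle lam)) fun _ => ψ F := by
    simp only [ex_const]
  rw [hconst]
  simp only [ex_uniform, ← Finset.mul_sum]
  simp only [Fintype.sum_prod_type] at hswap
  rw [hswap]

namespace QueryTree

/-- The points queried in the run with oracle `F`. -/
def queries (T : QueryTree lam α) (F : Oracle lam) : Set (Word lam) :=
  {x | ∃ b, (x, b) ∈ T.transcript F}

theorem eq_of_mem_transcript {T : QueryTree lam α} {F : Oracle lam} {x : Word lam} {b : Bool}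
    (h : (x, b) ∈ T.transcript F) : b = F x := by
  induction T with
  | output a => simp [transcript] at h
  | query y next ih =>
    rw [transcript, List.mem_cons] at h
    rcases h with h | h
    · cases h; rfl
    · exact ih _ h

theorem run_congr {T : QueryTree lam α} {F F' : Oracle lam}
    (h : ∀ x ∈ T.queries F, F' x = F x) :
    T.transcript F' = T.transcript F ∧ T.eval F' = T.eval F := by
  induction T with
  | output a => exact ⟨rfl, rfl⟩
  | query y next ih =>
    have hy : F' y = F y := h y ⟨F y, by simp [transcript]⟩
    have := ih (F y) fun x ⟨b, hb⟩ => h x ⟨b, by simp [transcript, hb]⟩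
    simp [transcript, eval, hy, this.1, this.2]

theorem transcript_congr {T : QueryTree lam α} {F F' : Oracle lam}
    (h : ∀ x ∈ T.queries F, F' x = F x) : T.transcript F' = T.transcript F := (run_congr h).1

theorem eval_congr {T : QueryTree lam α} {F F' : Oracle lam}
    (h : ∀ x ∈ T.queries F, F' x = F x) : T.eval F' = T.eval F := (run_congr h).2

theorem queries_congr {T : QueryTree lam α} {F F' : Oracle lam}
    (h : ∀ x ∈ T.queries F, F' x = F x) : T.queries F' = T.queries F := by
  simp only [queries, transcript_congr h]

open Classical in
theorem sum_queries_le {T : QueryTree lam α} {Q : ℕ} (hT : T.QueriesAtMost Q) (F : Oracle lam) :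
    ∑ x, (if x ∈ T.queries F then (1 : ℝ≥0∞) else 0) ≤ Q := by
  have h1 : ∑ x, (if x ∈ T.queries F then (1 : ℝ≥0∞) else 0) =
      ((Finset.univ.filter fun x => x ∈ T.queries F).card : ℝ≥0∞) := by simp
  rw [h1]
  have h2 : (Finset.univ.filter fun x => x ∈ T.queries F) ⊆
      ((T.transcript F).map Prod.fst).toFinset := by
    intro x hx
    simpa [queries] using hx
  have h3 := (Finset.card_le_card h2).trans (List.toFinset_card_le _)
  rw [List.length_map] at h3
  exact_mod_cast h3.trans (hT F)

end QueryTree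

/-- The oracle that answers as recorded in `S`, and like `G` elsewhere. -/
def fill (S : List (Word lam × Bool)) (G : Oracle lam) : Oracle lam :=
  fun x => (S.lookup x).getD (G x)

theorem ex_consistentOracle (S : List (Word lam × Bool)) (f : Oracle lam → ℝ≥0∞) :
    ex (consistentOracle S) f = ex (PMF.uniformOfFintype (Oracle lam)) fun G => f (fill S G) := by
  rw [consistentOracle, ex_map]
  rfl

theorem lookup_eq_none {S : List (Word lam × Bool)} {x : Word lam} (h : ∀ b, (x, b) ∉ S) :
    S.lookup x = none := by
  rw [List.lookup_eq_none_iff]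
  rintro ⟨y, b⟩ hy
  simp only [ne_eq, bne_iff_ne]
  rintro rfl
  exact h b hy

theorem exists_lookup_eq_some {S : List (Word lam × Bool)} {x : Word lam} {b : Bool}
    (h : (x, b) ∈ S) : ∃ b', (x, b') ∈ S ∧ S.lookup x = some b' := by
  induction S with
  | nil => simp at h
  | cons z S ih =>
    obtain ⟨y, c⟩ := z
    by_cases hxy : x = y
    · subst hxy
      exact ⟨c, by simp, by simp [List.lookup]⟩
    · have h' : (x, b) ∈ S := by
        rcases List.mem_cons.1 h with h | h
        · cases h; exact absurd rfl hxy
        · exact h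
      obtain ⟨b', h1, h2⟩ := ih h'
      refine ⟨b', List.mem_cons_of_mem _ h1, ?_⟩
      rw [List.lookup, beq_false_of_ne hxy]
      exact h2

theorem fill_of_notMem {S : List (Word lam × Bool)} {x : Word lam} (h : ∀ b, (x, b) ∉ S)
    (G : Oracle lam) : fill S G x = G x := by
  simp [fill, lookup_eq_none h]

theorem fill_of_mem {S : List (Word lam × Bool)} {x : Word lam} {b : Bool} (h : (x, b) ∈ S)
    (G G' : Oracle lam) : fill S G x = fill S G' x := by
  obtain ⟨b', -, h'⟩ := exists_lookup_eq_some h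
  simp [fill, h']

/-- The table of all query-response pairs of the runs of the algorithms `v`. -/
def tableOf {N : ℕ} (v : Fin N → QueryTree lam α) (F : Oracle lam) : List (Word lam × Bool) :=
  (List.ofFn fun i => (v i).transcript F).flatten

theorem mem_tableOf {N : ℕ} {v : Fin N → QueryTree lam α} {F : Oracle lam} {z : Word lam × Bool} :
    z ∈ tableOf v F ↔ ∃ i, z ∈ (v i).transcript F := by
  simp only [tableOf, List.mem_flatten, List.mem_ofFn]
  constructor
  · rintro ⟨_, ⟨i, rfl⟩, h⟩
    exact ⟨i, h⟩
  · rintro ⟨i, h⟩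
    exact ⟨_, ⟨i, rfl⟩, h⟩

theorem tableOf_congr {N : ℕ} {v : Fin N → QueryTree lam α} {F F' : Oracle lam}
    (h : ∀ x, (∃ b, (x, b) ∈ tableOf v F) → F' x = F x) : tableOf v F' = tableOf v F := by
  unfold tableOf
  congr 2
  ext1 i
  exact QueryTree.transcript_congr fun x ⟨b, hb⟩ => h x ⟨b, mem_tableOf.2 ⟨i, hb⟩⟩

/-- All recorded answers are those of `F`, so repeated entries agree. In the form of `patch`, the
consistent oracle is open to the resampling argument. -/
theorem fill_tableOf {N : ℕ} (v : Fin N → QueryTree lam α) (F G : Oracle lam) :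
    fill (tableOf v F) G = patch {x | ∃ b, (x, b) ∈ tableOf v F} F G := by
  ext1 x
  by_cases hx : ∃ b, (x, b) ∈ tableOf v F
  · rw [patch_of_mem hx]
    obtain ⟨b, hb⟩ := hx
    obtain ⟨b', h1, h2⟩ := exists_lookup_eq_some hb
    obtain ⟨i, hi⟩ := mem_tableOf.1 h1
    simp [fill, h2, QueryTree.eq_of_mem_transcript hi]
  · rw [patch_of_notMem hx, fill_of_notMem (not_exists.1 hx)]

/-- Lazy sampling: a fresh random oracle consistent with the recorded answers is distributed like
the original one, jointly with the record. -/
theorem ex_consistentOracle_tableOf {N : ℕ} (v : Fin N → QueryTree lam α)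
    (ψ : List (Word lam × Bool) → Oracle lam → ℝ≥0∞) :
    (ex (PMF.uniformOfFintype (Oracle lam)) fun F =>
      ex (consistentOracle (tableOf v F)) fun G => ψ (tableOf v F) G) =
    ex (PMF.uniformOfFintype (Oracle lam)) fun F => ψ (tableOf v F) F := by
  rw [← ex_patch (fun F => {x | ∃ b, (x, b) ∈ tableOf v F})
    (fun F F' h => by simp only [tableOf_congr h]) fun F => ψ (tableOf v F) F]
  simp only [ex_consistentOracle, fill_tableOf]
  congr! 5 with F G
  exact (tableOf_congr fun x hx => patch_of_mem hx _ _).symm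

open Classical in
/-- Replacing the oracle of the second of two correlated algorithms by an independent one changes
its result only if both query a common point outside the table. -/
theorem ex_shared_oracle_le (S : List (Word lam × Bool)) (T : QueryTree lam α)
    (κ : α → PMF (QueryTree lam Bool)) :
    (ex (consistentOracle S) fun F => ex (κ (T.eval F)) fun T' => if T'.eval F then 1 else 0) ≤
    ex (consistentOracle S) fun F₁ => ex (consistentOracle S) fun F₂ =>
      ex (κ (T.eval F₁)) fun T' => (if T'.eval F₂ then 1 else 0) +
        if ∃ y, (∀ b, (y, b) ∉ S) ∧ y ∈ T.queries F₁ ∧ y ∈ T'.queries F₂ then 1 else 0 := by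
  simp only [ex_consistentOracle]
  have hD : ∀ G G' : Oracle lam, (∀ x ∈ T.queries (fill S G), G' x = G x) →
      ∀ x ∈ T.queries (fill S G), fill S G' x = fill S G x := by
    intro G G' h x hx
    by_cases hS : ∀ b, (x, b) ∉ S
    · rw [fill_of_notMem hS, fill_of_notMem hS, h x hx]
    · push Not at hS
      exact fill_of_mem hS.choose_spec _ _
  -- Resample the shared oracle outside the queries of `T`. The run of `T` does not change, and the
  -- second algorithm now meets `G₂` except at stored points and at queries of `T`.
  rw [← ex_patch (fun G => T.queries (fill S G)) fun G G' h => QueryTree.queries_congr (hD G G' h)]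
  refine ex_le_ex _ fun G₁ _ => ex_le_ex _ fun G₂ _ => ?_
  have heval := QueryTree.eval_congr (hD G₁ (patch (T.queries (fill S G₁)) G₁ G₂)
    fun x hx => patch_of_mem hx _ _)
  rw [heval]
  refine ex_le_ex _ fun T' _ => ?_
  by_cases hbad : ∃ y, (∀ b, (y, b) ∉ S) ∧ y ∈ T.queries (fill S G₁) ∧ y ∈ T'.queries (fill S G₂)
  · rw [if_pos hbad]
    refine le_add_left ?_
    split_ifs
    exacts [le_rfl, zero_le_one]
  · rw [if_neg hbad, add_zero]
    have : T'.eval (fill S (patch (T.queries (fill S G₁)) G₁ G₂)) = T'.eval (fill S G₂) := by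
      refine QueryTree.eval_congr fun y hy => ?_
      by_cases hS : ∀ b, (y, b) ∉ S
      · rw [fill_of_notMem hS, fill_of_notMem hS, patch_of_notMem]
        exact fun hy1 => hbad ⟨y, hS, hy1, hy⟩
      · push Not at hS
        exact fill_of_mem hS.choose_spec _ _
    rw [this]

end oracle

/-! ### Key generation of the compiled scheme -/

section keys

variable {lam n : ℕ}

/-- The decoder on a uniformly random word. -/
noncomputable def decTree (P : ROCode lam n) (sk : List Bool) : PMF (QueryTree lam Bool) :=
  (PMF.uniformOfFintype (Word n)).bind fun x => P.dec sk x

theorem decoderRun_eq (P : ROCode lam n) (sk : List Bool) (F : Oracle lam) :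
    decoderRun P sk F = (decTree P sk).map fun T => T.transcript F := by
  rw [decTree, PMF.map_bind]
  rfl

theorem decoderTable_eq (P : ROCode lam n) (N : ℕ) (sk : List Bool) (F : Oracle lam) :
    decoderTable P N sk F = (iid (decTree P sk) N).map fun v => tableOf v F := by
  rw [decoderTable, decoderRun_eq, iid_map, PMF.map_comp]
  rfl

/-- The joint distribution of the old key and of the table. -/
noncomputable def tableKey (P : ROCode lam n) (N : ℕ) :
    PMF (List Bool × List (Word lam × Bool)) :=
  P.keyGen.bind fun sk => (PMF.uniformOfFintype (Oracle lam)).bind fun F₀ =>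
    (decoderTable P N sk F₀).map fun S => (sk, S)

theorem ex_tableKey (P : ROCode lam n) (N : ℕ)
    (f : List Bool × List (Word lam × Bool) → ℝ≥0∞) :
    ex (tableKey P N) f = ex P.keyGen fun sk => ex (PMF.uniformOfFintype (Oracle lam)) fun F =>
      ex (iid (decTree P sk) N) fun v => f (sk, tableOf v F) := by
  simp only [tableKey, ex_bind, ex_map, decoderTable_eq]

/-- The coins of the table runs are independent of the oracle. With them fixed, lazy sampling
replaces the resampled oracle by the one that produced the table. -/
theorem ex_tableKey_consistentOracle (P : ROCode lam n) (N : ℕ)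
    (ψ : List Bool × List (Word lam × Bool) → Oracle lam → ℝ≥0∞) :
    (ex (tableKey P N) fun k => ex (consistentOracle k.2) fun F => ψ k F) =
      ex P.keyGen fun sk => ex (PMF.uniformOfFintype (Oracle lam)) fun F =>
        ex (iid (decTree P sk) N) fun v => ψ (sk, tableOf v F) F := by
  rw [ex_tableKey]
  congr! 2 with sk
  refine (ex_comm _ _ _).trans (Eq.trans ?_ (ex_comm _ _ _))
  congr! 2 with v
  exact ex_consistentOracle_tableOf v fun S F => ψ (sk, S) F

/-- Without the table, the oracle of the compiled scheme is a random oracle. -/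
theorem ex_tableKey_oracle (P : ROCode lam n) (N : ℕ) (ψ : List Bool → Oracle lam → ℝ≥0∞) :
    (ex (tableKey P N) fun k => ex (consistentOracle k.2) fun F => ψ k.1 F) =
      ex P.inROM.keyGen fun k => ψ k.1 k.2 := by
  rw [ex_tableKey_consistentOracle P N fun k F => ψ k.1 F]
  simp only [ROCode.inROM, ex_bind, ex_map, ex_const]

theorem length_tableOf_le {N Q : ℕ} {α : Type} {v : Fin N → QueryTree lam α}
    (hv : ∀ i, (v i).QueriesAtMost Q) (F : Oracle lam) : (tableOf v F).length ≤ Q * N := by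
  rw [tableOf, List.length_flatten, List.map_ofFn, List.sum_ofFn]
  refine (Finset.sum_le_card_nsmul _ _ Q fun i _ => hv i F).trans ?_
  simp [mul_comm]

theorem queriesAtMost_of_mem_decTree {P : ROCode lam n} {Q : ℕ} (hP : P.QueriesAtMost Q)
    {sk : List Bool} (hsk : sk ∈ P.keyGen.support) {T : QueryTree lam Bool}
    (hT : T ∈ (decTree P sk).support) : T.QueriesAtMost Q := by
  rw [decTree, PMF.mem_support_bind_iff] at hT
  obtain ⟨x, -, hx⟩ := hT
  exact (hP sk hsk).2 x T hx

theorem mem_support_tableKey {P : ROCode lam n} {Q N : ℕ} (hP : P.QueriesAtMost Q)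
    {k : List Bool × List (Word lam × Bool)} (hk : k ∈ (tableKey P N).support) :
    k.1 ∈ P.keyGen.support ∧ k.2.length ≤ Q * N := by
  simp only [tableKey, decoderTable_eq, PMF.mem_support_bind_iff, PMF.mem_support_map_iff] at hk
  obtain ⟨sk, hsk, F, -, S, ⟨v, hv, rfl⟩, rfl⟩ := hk
  exact ⟨hsk, length_tableOf_le
    (fun i => queriesAtMost_of_mem_decTree hP hsk (iid_support _ hv i)) F⟩

/-! ### Keys as bit strings -/

theorem length_encodeSlot (o : Option (Word lam × Bool)) : (encodeSlot o).length = lam + 2 := by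
  rcases o with _ | ⟨x, b⟩ <;> simp [encodeSlot]

theorem decodeSlot_encodeSlot (o : Option (Word lam × Bool)) :
    decodeSlot lam (encodeSlot o) = o := by
  rcases o with _ | ⟨x, b⟩
  · simp [decodeSlot, encodeSlot, List.replicate_succ]
  · simp [decodeSlot, encodeSlot]

theorem length_flatMap_encodeSlot (l : List ℕ) (g : ℕ → Option (Word lam × Bool)) :
    (l.flatMap fun i => encodeSlot (g i)).length = l.length * (lam + 2) := by
  rw [List.length_flatMap]
  simp [length_encodeSlot]

theorem length_encodeKey (N : ℕ) (sk : List Bool) (S : List (Word lam × Bool)) :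
    (encodeKey N sk S).length = N * (lam + 2) + sk.length := by
  rw [encodeKey, List.length_append, length_flatMap_encodeSlot, List.length_range]

theorem take_drop_encodeKey {N i : ℕ} (hi : i < N) (sk : List Bool) (S : List (Word lam × Bool)) :
    ((encodeKey N sk S).drop (i * (lam + 2))).take (lam + 2) = encodeSlot S[i]? := by
  obtain ⟨j, rfl⟩ : ∃ j, N = i + 1 + j := ⟨N - (i + 1), by omega⟩
  rw [encodeKey, List.range_add, List.range_succ, List.flatMap_append, List.flatMap_append,
    List.append_assoc, List.append_assoc, List.drop_left', List.flatMap_singleton,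
    List.take_left' (length_encodeSlot _)]
  rw [length_flatMap_encodeSlot, List.length_range]

theorem filterMap_range_getElem? {β : Type} (S : List β) (N : ℕ) (h : S.length ≤ N) :
    ((List.range N).filterMap fun i => S[i]?) = S := by
  induction S generalizing N with
  | nil => simp
  | cons a S ih =>
    obtain ⟨N, rfl⟩ : ∃ M, N = M + 1 := ⟨N - 1, by simp at h; omega⟩
    rw [List.range_succ_eq_map, List.filterMap_cons_some (b := a) (by simp), List.filterMap_map]
    congr 1
    exact ih N (by simpa using h)

theorem parseKey_encodeKey {N : ℕ} (sk : List Bool) {S : List (Word lam × Bool)}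
    (h : S.length ≤ N) : parseKey lam N (encodeKey N sk S) = (sk, S) := by
  unfold parseKey
  congr 1
  · rw [encodeKey, List.drop_left']
    rw [length_flatMap_encodeSlot, List.length_range]
  · conv_rhs => rw [← filterMap_range_getElem? S N h]
    refine List.filterMap_congr fun i hi => ?_
    rw [take_drop_encodeKey (List.mem_range.1 hi), decodeSlot_encodeSlot]

theorem compile_keyGen (P : ROCode lam n) (Q : ℕ) (τ : ℝ) :
    (compile P Q τ).keyGen = (tableKey P ⌈lam / τ⌉₊).map fun k =>
      encodeKey (Q * ⌈lam / τ⌉₊) k.1 k.2 := by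
  simp only [compile, tableKey, PMF.map_bind, PMF.map_comp]
  rfl

theorem ex_compile_keyGen {P : ROCode lam n} {Q : ℕ} (hP : P.QueriesAtMost Q) (τ : ℝ)
    (f : List Bool × List (Word lam × Bool) → ℝ≥0∞) :
    (ex (compile P Q τ).keyGen fun k => f (parseKey lam (Q * ⌈lam / τ⌉₊) k)) =
      ex (tableKey P ⌈lam / τ⌉₊) f := by
  rw [compile_keyGen, ex_map]
  exact ex_congr _ fun k hk => by rw [parseKey_encodeKey _ (mem_support_tableKey hP hk).2]

theorem length_of_mem_compile_keyGen {P : ROCode lam n} {Q ℓ : ℕ}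
    (hℓ : ∀ sk ∈ P.keyGen.support, sk.length ≤ ℓ) (hP : P.QueriesAtMost Q) {τ : ℝ}
    {k : List Bool} (hk : k ∈ (compile P Q τ).keyGen.support) :
    k.length ≤ ℓ + Q * ⌈lam / τ⌉₊ * (lam + 2) := by
  rw [compile_keyGen, PMF.mem_support_map_iff] at hk
  obtain ⟨k', hk', rfl⟩ := hk
  rw [length_encodeKey]
  have := hℓ _ (mem_support_tableKey hP hk').1
  omega

theorem mul_ceil_le {lam Q : ℕ} (hlam : 1 ≤ lam) {τ : ℝ} (hτ0 : 0 < τ) (hτ1 : τ < 1) :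
    ((Q * ⌈lam / τ⌉₊ * (lam + 2) : ℕ) : ℝ) ≤ 6 * (Q * (lam : ℝ) ^ 2 / τ) := by
  have hl : (1 : ℝ) ≤ lam := by exact_mod_cast hlam
  have h1 : (1 : ℝ) ≤ lam / τ := by
    rw [le_div_iff₀ hτ0]; linarith
  have h2 : (⌈(lam : ℝ) / τ⌉₊ : ℝ) ≤ 2 * (lam / τ) := by
    have := (Nat.ceil_lt_add_one (by linarith : 0 ≤ (lam : ℝ) / τ)).le
    linarith
  push_cast
  -- The constant is `6 = 2 * 3`: the ceiling at most doubles `lam / τ ≥ 1`, and `lam + 2 ≤ 3 *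
  -- lam`.
  calc (Q : ℝ) * ⌈(lam : ℝ) / τ⌉₊ * (lam + 2) ≤ Q * (2 * (lam / τ)) * (3 * lam) := by
        gcongr
        linarith
    _ = _ := by ring

/-! ### Heavy queries -/

open Classical in
/-- The probability that the decoder queries `x` on a uniformly random word. -/
noncomputable def queryProb (P : ROCode lam n) (sk : List Bool) (F : Oracle lam) (x : Word lam) :
    ℝ≥0∞ :=
  ex (decTree P sk) fun T => if x ∈ T.queries F then 1 else 0

theorem queryProb_le_one (P : ROCode lam n) (sk : List Bool) (F : Oracle lam) (x : Word lam) :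
    queryProb P sk F x ≤ 1 := by
  refine ex_le_const _ fun T _ => ?_
  split_ifs
  exacts [le_rfl, zero_le_one]

theorem heavy_iff (P : ROCode lam n) (τ : ℝ) (sk : List Bool) (F : Oracle lam) (x : Word lam) :
    Heavy P τ sk F x ↔ τ ≤ (queryProb P sk F x).toReal := by
  rw [Heavy, prob, decoderRun_eq, PMF.map_comp, map_true_eq_ex]
  rfl

theorem sum_queryProb_le {P : ROCode lam n} {Q : ℕ} (hP : P.QueriesAtMost Q) {sk : List Bool}
    (hsk : sk ∈ P.keyGen.support) (F : Oracle lam) : ∑ x, queryProb P sk F x ≤ Q := by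
  classical
  simp only [queryProb]
  rw [← ex_sum]
  exact ex_le_const _ fun T hT =>
    QueryTree.sum_queries_le (queriesAtMost_of_mem_decTree hP hsk hT) F

/-- The table `S` misses a heavy query. -/
def Misses (P : ROCode lam n) (τ : ℝ) (sk : List Bool) (F : Oracle lam)
    (S : List (Word lam × Bool)) : Prop :=
  ∃ x, Heavy P τ sk F x ∧ ∀ b, (x, b) ∉ S

/-- The left side is at most `exp(-τ * ⌈lam/τ⌉) ≤ exp(-lam)`, and `e ≥ 2`. -/
theorem one_sub_pow_ceil_le {lam : ℕ} {τ : ℝ} (hτ0 : 0 < τ) {h : ℝ} (hh : τ ≤ h) (hh1 : h ≤ 1) :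
    (1 - h) ^ ⌈lam / τ⌉₊ ≤ (2⁻¹ : ℝ) ^ lam := by
  have h1 : (1 - h) ^ ⌈lam / τ⌉₊ ≤ Real.exp (-τ) ^ ⌈lam / τ⌉₊ := by
    refine pow_le_pow_left₀ (by linarith) ?_ _
    linarith [Real.one_sub_le_exp_neg τ]
  have h2 : Real.exp (-1) ≤ 2⁻¹ := by
    rw [Real.exp_neg]
    exact inv_anti₀ (by norm_num) (by linarith [Real.add_one_le_exp 1])
  calc _ ≤ _ := h1
    _ = Real.exp (-(⌈lam / τ⌉₊ * τ)) := by rw [← Real.exp_nat_mul]; congr 1; ring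
    _ ≤ Real.exp (lam * (-1)) := by
        refine Real.exp_le_exp.2 ?_
        have := mul_le_mul_of_nonneg_right (Nat.le_ceil (lam / τ)) hτ0.le
        rw [div_mul_cancel₀ _ hτ0.ne'] at this
        linarith
    _ = Real.exp (-1) ^ lam := Real.exp_nat_mul _ _
    _ ≤ _ := pow_le_pow_left₀ (Real.exp_nonneg _) h2 _

-- Union bound over the heavy points for a fixed oracle: each escapes all runs with probability at
-- most `2^{-λ}`, and there are at most `Q/τ` of them because the query probabilities sum to at most
-- `Q`.
open Classical in
theorem ex_misses_le {P : ROCode lam n} {Q : ℕ} (hP : P.QueriesAtMost Q) {τ : ℝ} (hτ0 : 0 < τ)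
    {sk : List Bool} (hsk : sk ∈ P.keyGen.support) (F : Oracle lam) :
    (ex (iid (decTree P sk) ⌈lam / τ⌉₊) fun v =>
      if Misses P τ sk F (tableOf v F) then 1 else 0) ≤
      ENNReal.ofReal ((2⁻¹ : ℝ) ^ lam * Q / τ) := by
  set N := ⌈lam / τ⌉₊
  have hnot : ∀ x, (ex (decTree P sk) fun T => if x ∈ T.queries F then 0 else 1) =
      ENNReal.ofReal (1 - (queryProb P sk F x).toReal) := by
    intro x
    have h1 : (ex (decTree P sk) fun T => if x ∈ T.queries F then 0 else 1) +
        queryProb P sk F x = 1 := by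
      rw [queryProb, ← ex_add]
      refine Eq.trans ?_ (ex_const (decTree P sk) 1)
      congr! 2 with T
      split_ifs <;> simp
    have hne : queryProb P sk F x ≠ ⊤ := ne_top_of_le_ne_top (by simp) (queryProb_le_one P sk F x)
    rw [ENNReal.ofReal_sub _ ENNReal.toReal_nonneg, ENNReal.ofReal_one, ENNReal.ofReal_toReal hne]
    exact ENNReal.eq_sub_of_add_eq hne h1
  calc _ ≤ ex (iid (decTree P sk) N) fun v => ∑ x, if Heavy P τ sk F x then
          ∏ i, (if x ∈ (v i).queries F then 0 else 1) else 0 := by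
        refine ex_le_ex _ fun v _ => ?_
        split_ifs with hv
        · obtain ⟨x, hx, hxS⟩ := hv
          refine le_trans ?_ (Finset.single_le_sum (fun _ _ => zero_le) (Finset.mem_univ x))
          rw [if_pos hx, Finset.prod_eq_one fun i _ => if_neg ?_]
          rintro ⟨b, hb⟩
          exact hxS b (mem_tableOf.2 ⟨i, hb⟩)
        · exact zero_le
    _ = ∑ x, if Heavy P τ sk F x then ENNReal.ofReal (1 - (queryProb P sk F x).toReal) ^ N
          else 0 := by
        rw [ex_sum]
        refine Finset.sum_congr rfl fun x _ => ?_
        split_ifs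
        · rw [ex_iid_prod _ _ fun T : QueryTree lam Bool => if x ∈ T.queries F then 0 else 1, hnot]
        · exact ex_const _ _
    -- For a heavy `x` the factor `queryProb / τ` is at least `1`; inserting it counts the heavy
    -- points implicitly.
    _ ≤ ∑ x, queryProb P sk F x * ENNReal.ofReal ((2⁻¹ : ℝ) ^ lam / τ) := by
        refine Finset.sum_le_sum fun x _ => ?_
        split_ifs with hx
        · rw [heavy_iff] at hx
          have hne : queryProb P sk F x ≠ ⊤ :=
            ne_top_of_le_ne_top (by simp) (queryProb_le_one P sk F x)
          have hle : (queryProb P sk F x).toReal ≤ 1 := by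
            simpa using ENNReal.toReal_mono (by simp) (queryProb_le_one P sk F x)
          rw [← ENNReal.ofReal_pow (by linarith)]
          nth_rewrite 2 [← ENNReal.ofReal_toReal hne]
          rw [← ENNReal.ofReal_mul ENNReal.toReal_nonneg]
          refine ENNReal.ofReal_le_ofReal ((one_sub_pow_ceil_le hτ0 hx hle).trans ?_)
          rw [← mul_div_assoc, le_div_iff₀ hτ0, mul_comm]
          gcongr
        · exact zero_le
    _ ≤ Q * ENNReal.ofReal ((2⁻¹ : ℝ) ^ lam / τ) := by
        rw [← Finset.sum_mul]
        gcongr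
        exact sum_queryProb_le hP hsk F
    _ = _ := by
        rw [← ENNReal.ofReal_natCast, ← ENNReal.ofReal_mul (Nat.cast_nonneg _)]
        congr 1
        ring

open Classical in
theorem ex_keyGen_misses_le {P : ROCode lam n} {Q : ℕ} (hP : P.QueriesAtMost Q) {τ : ℝ}
    (hτ0 : 0 < τ) :
    (ex P.keyGen fun sk => ex (PMF.uniformOfFintype (Oracle lam)) fun F =>
      ex (iid (decTree P sk) ⌈lam / τ⌉₊) fun v =>
        if Misses P τ sk F (tableOf v F) then 1 else 0) ≤
      ENNReal.ofReal ((2⁻¹ : ℝ) ^ lam * Q / τ) :=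
  ex_le_const _ fun _ hsk => ex_le_const _ fun F _ => ex_misses_le hP hτ0 hsk F

theorem missProbability_le {P : ROCode lam n} {Q : ℕ} (hP : P.QueriesAtMost Q) {τ : ℝ}
    (hτ0 : 0 < τ) : missProbability P τ ≤ (2⁻¹ : ℝ) ^ lam * Q / τ := by
  classical
  refine ENNReal.toReal_le_of_le_ofReal (by positivity)
    (le_trans (le_of_eq ?_) (ex_keyGen_misses_le hP hτ0))
  simp only [bind_apply_eq_ex, map_true_eq_ex, decoderTable_eq, ex_map]
  rfl

end keys

/-! ### Completeness of the compiled scheme -/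

section completeness

variable {lam n : ℕ}

/-- The total variation distance of a random word from uniform. -/
noncomputable def distUniform (M : PMF (Word n)) : ℝ := ∑ c, max ((M c).toReal - (2 ^ n)⁻¹) 0

theorem distUniform_nonneg (M : PMF (Word n)) : 0 ≤ distUniform M :=
  Finset.sum_nonneg fun _ _ => le_max_right _ _

/-- Here `g y c` is the joint weight of codeword `c` and encoder query `y`, so that `g y c / M c`
plays the role of the conditional probability `G`. -/
theorem sum_collision_le (ρ : unitInterval) {ι : Type} [Fintype ι] {Q : ℕ} {τ : ℝ} (hτ : 0 < τ)
    (M : PMF (Word n)) {g φ : ι → Word n → ℝ≥0∞} (hgM : ∀ y c, g y c ≤ M c)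
    (hgQ : ∀ c, ∑ y, g y c ≤ Q * M c) (hφ1 : ∀ y c, φ y c ≤ 1) (hφQ : ∀ c, ∑ y, φ y c ≤ Q)
    (hφτ : ∀ y, ex (PMF.uniformOfFintype (Word n)) (φ y) ≤ ENNReal.ofReal τ) :
    ∑ c, ∑ y, g y c * ex (noise ρ c) (φ y) ≤
      ENNReal.ofReal (Q * τ ^ ((1 / 2 : ℝ) * ((1 - (ρ : ℝ) ^ 2) / (1 + (ρ : ℝ) ^ 2))) +
        Q * distUniform M) := by
  have hM : ∀ c, M c ≠ ⊤ := M.apply_ne_top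
  have hg : ∀ y c, g y c ≠ ⊤ := fun y c => ne_top_of_le_ne_top (hM c) (hgM y c)
  have hφ : ∀ y c, φ y c ≠ ⊤ := fun y c => ne_top_of_le_ne_top ENNReal.one_ne_top (hφ1 y c)
  have hgM' : ∀ y c, (g y c).toReal ≤ (M c).toReal := fun y c => ENNReal.toReal_mono (hM c) (hgM y c)
  have key := light_collision_of_distribution (G := fun y c => (g y c).toReal / (M c).toReal)
    (f := fun y c => (φ y c).toReal) (D := fun c => (M c).toReal) (Q := Q) ρ.2.1 ρ.2.2 hτ
    (fun y c => div_nonneg ENNReal.toReal_nonneg ENNReal.toReal_nonneg)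
    (fun y c => div_le_one_of_le₀ (hgM' y c) ENNReal.toReal_nonneg)
    (fun c => ?_) (fun y c => ENNReal.toReal_nonneg)
    (fun y c => by simpa using ENNReal.toReal_mono ENNReal.one_ne_top (hφ1 y c)) (fun c => ?_)
    (fun y => ?_)
  · refine le_trans (le_of_eq ?_) (ENNReal.ofReal_le_ofReal key)
    have hT0 : ∀ y c, 0 ≤ noiseOp ρ n (fun c => (φ y c).toReal) c := fun y c =>
      noiseOp_nonneg ρ.2.1 ρ.2.2 (fun _ => ENNReal.toReal_nonneg) c
    -- Division by `M c = 0` is harmless, since `g y c` vanishes there too.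
    have hMg : ∀ y c, (M c).toReal * ((g y c).toReal / (M c).toReal) = (g y c).toReal := by
      intro y c
      rcases (ENNReal.toReal_nonneg (a := M c)).eq_or_lt with h | h
      · have : (g y c).toReal = 0 := le_antisymm (h ▸ hgM' y c) ENNReal.toReal_nonneg
        rw [this, ← h]; simp
      · field_simp
    simp only [hMg]
    rw [ENNReal.ofReal_sum_of_nonneg fun c _ => Finset.sum_nonneg fun y _ =>
      mul_nonneg ENNReal.toReal_nonneg (hT0 y c)]
    refine Finset.sum_congr rfl fun c _ => ?_
    rw [ENNReal.ofReal_sum_of_nonneg fun y _ => mul_nonneg ENNReal.toReal_nonneg (hT0 y c)]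
    refine Finset.sum_congr rfl fun y _ => ?_
    rw [ENNReal.ofReal_mul ENNReal.toReal_nonneg, ENNReal.ofReal_toReal (hg y c),
      ← ex_noise ρ c fun _ => ENNReal.toReal_nonneg]
    simp only [ENNReal.ofReal_toReal (hφ y _)]
  · rw [← Finset.sum_div, ← ENNReal.toReal_sum fun y _ => hg y c]
    refine div_le_of_le_mul₀ ENNReal.toReal_nonneg (Nat.cast_nonneg _) ?_
    simpa using ENNReal.toReal_mono (ENNReal.mul_ne_top (ENNReal.natCast_ne_top Q) (hM c)) (hgQ c)
  · rw [← ENNReal.toReal_sum fun y _ => hφ y c]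
    simpa using ENNReal.toReal_mono (ENNReal.natCast_ne_top Q) (hφQ c)
  · have := ENNReal.toReal_mono ENNReal.ofReal_ne_top (hφτ y)
    rw [ENNReal.toReal_ofReal hτ.le, ex_uniform, ENNReal.toReal_mul,
      ENNReal.toReal_sum fun x _ => hφ y x] at this
    rw [div_eq_inv_mul]
    simpa using this

/-- The codeword of the compiled scheme for the key `sk` and the table `S`. -/
noncomputable def encLaw (P : ROCode lam n) (sk : List Bool) (S : List (Word lam × Bool)) :
    PMF (Word n) :=
  (consistentOracle S).bind fun F => (P.enc sk).map fun T => T.eval F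

open Classical in
/-- With independent oracles, the encoder and the decoder rarely ask a common query that is not
stored in the table. -/
theorem ex_collision_le {P : ROCode lam n} {Q : ℕ} (hP : P.QueriesAtMost Q) (ρ : unitInterval)
    {τ : ℝ} (hτ : 0 < τ) {sk : List Bool} (hsk : sk ∈ P.keyGen.support)
    (S : List (Word lam × Bool)) :
    (ex (P.enc sk) fun T => ex (consistentOracle S) fun F₁ => ex (consistentOracle S) fun F₂ =>
      ex ((noise ρ (T.eval F₁)).bind (P.dec sk)) fun T' =>
        if ∃ y, (∀ b, (y, b) ∉ S) ∧ y ∈ T.queries F₁ ∧ y ∈ T'.queries F₂ then (1 : ℝ≥0∞) else 0) ≤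
      (ex (consistentOracle S) fun F => if Misses P τ sk F S then 1 else 0) +
      ENNReal.ofReal (Q * τ ^ ((1 / 2 : ℝ) * ((1 - (ρ : ℝ) ^ 2) / (1 + (ρ : ℝ) ^ 2))) +
        Q * distUniform (encLaw P sk S)) := by
  -- The indicator that no heavy query is missed is built into `φ`, so every point that still counts
  -- is light and `φ y` has mean at most `τ`.
  set φ : Word lam → Word n → ℝ≥0∞ := fun y c => ex (consistentOracle S) fun F =>
    (if ¬ Misses P τ sk F S ∧ ∀ b, (y, b) ∉ S then 1 else 0) *
      ex (P.dec sk c) fun T' => if y ∈ T'.queries F then 1 else 0 with hφ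
  set g : Word lam → Word n → ℝ≥0∞ := fun y c => ex (P.enc sk) fun T =>
    ex (consistentOracle S) fun F => (if y ∈ T.queries F then 1 else 0) *
      if T.eval F = c then 1 else 0 with hg
  have hM : ∀ c, encLaw P sk S c = ex (P.enc sk) fun T => ex (consistentOracle S) fun F =>
      if T.eval F = c then 1 else 0 := by
    intro c
    rw [apply_eq_ex, encLaw, ex_bind, ex_comm]
    simp only [ex_map]
  have hind : ∀ (p : Prop) [Decidable p], (if p then (1 : ℝ≥0∞) else 0) ≤ 1 := by
    intro p _
    split_ifs
    exacts [le_rfl, zero_le_one]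
  have hcol := sum_collision_le ρ hτ (encLaw P sk S) (g := g) (φ := φ) (Q := Q) ?_ ?_ ?_ ?_ ?_
  · refine le_trans ?_ (add_le_add_right hcol _)
    calc _ ≤ ex (P.enc sk) fun T => ex (consistentOracle S) fun F₁ =>
          ex (consistentOracle S) fun F₂ => ex ((noise ρ (T.eval F₁)).bind (P.dec sk)) fun T' =>
            (if Misses P τ sk F₂ S then 1 else 0) +
              ∑ y, (if y ∈ T.queries F₁ then 1 else 0) *
                ((if ¬ Misses P τ sk F₂ S ∧ ∀ b, (y, b) ∉ S then 1 else 0) *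
                  if y ∈ T'.queries F₂ then 1 else 0) := by
          refine ex_le_ex _ fun T _ => ex_le_ex _ fun F₁ _ => ex_le_ex _ fun F₂ _ =>
            ex_le_ex _ fun T' _ => ?_
          by_cases hm : Misses P τ sk F₂ S
          · rw [if_pos hm]
            exact le_add_right (hind _)
          · rw [if_neg hm, zero_add]
            split_ifs with h
            · obtain ⟨y, hyS, hy1, hy2⟩ := h
              refine le_trans ?_ (Finset.single_le_sum (fun _ _ => zero_le) (Finset.mem_univ y))
              rw [if_pos hy1, if_pos ⟨hm, hyS⟩, if_pos hy2, one_mul, one_mul]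
            · exact zero_le
      -- Given the codeword, the encoder's queries under `F₁` and the decoder's under `F₂` are
      -- independent, so the sum splits into products of `g` and the noisy average of `φ`.
      _ = _ := by
          simp only [ex_add, ex_const, ex_sum, ex_bind, ex_const_mul]
          congr 1
          rw [Finset.sum_comm]
          refine Finset.sum_congr rfl fun y _ => ?_
          simp only [hg]
          have h1 : ∀ c, ex (noise ρ c) (φ y) = ex (consistentOracle S) fun F =>
              (if ¬ Misses P τ sk F S ∧ ∀ b, (y, b) ∉ S then 1 else 0) * ex (noise ρ c) fun c' =>
                ex (P.dec sk c') fun T' => if y ∈ T'.queries F then 1 else 0 := by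
            intro c
            rw [hφ, ex_comm]
            simp only [ex_const_mul]
          simp only [← ex_mul_const]
          rw [← ex_sum]
          refine congrArg _ (funext fun T => ?_)
          rw [← ex_sum]
          refine congrArg _ (funext fun F => ?_)
          simp only [mul_assoc, ← Finset.mul_sum]
          simp only [ite_mul, one_mul, zero_mul, Finset.sum_ite_eq, Finset.mem_univ, if_true, h1]
  · intro y c
    rw [hM]
    exact ex_le_ex _ fun T _ => ex_le_ex _ fun F _ => mul_le_of_le_one_left' (hind _)
  · intro c
    rw [hM, ← ex_sum, ← ex_const_mul]
    refine ex_le_ex _ fun T hT => ?_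
    rw [← ex_sum, ← ex_const_mul]
    refine ex_le_ex _ fun F _ => ?_
    rw [← Finset.sum_mul]
    gcongr
    exact QueryTree.sum_queries_le ((hP sk hsk).1 T hT) F
  · intro y c
    exact ex_le_const _ fun F _ => mul_le_one' (hind _) (ex_le_const _ fun _ _ => hind _)
  · intro c
    rw [← ex_sum]
    refine ex_le_const _ fun F _ => le_trans (Finset.sum_le_sum fun y _ =>
      mul_le_of_le_one_left' (hind _)) ?_
    rw [← ex_sum]
    exact ex_le_const _ fun T hT => QueryTree.sum_queries_le ((hP sk hsk).2 c T hT) F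
  · intro y
    rw [hφ, ex_comm]
    refine ex_le_const _ fun F _ => ?_
    rw [ex_const_mul]
    split_ifs with h
    · rw [one_mul]
      have h1 : ¬ Heavy P τ sk F y := fun hy => h.1 ⟨y, hy, h.2⟩
      rw [heavy_iff, not_le] at h1
      have h2 : queryProb P sk F y ≠ ⊤ := ne_top_of_le_ne_top (by simp) (queryProb_le_one P sk F y)
      rw [← ex_bind, ← decTree]
      exact (ENNReal.le_ofReal_iff_toReal_le h2 hτ.le).2 h1.le
    · rw [zero_mul]
      exact zero_le

/-- Lazy sampling rewrites the original experiment as one with the compiled key and a single shared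
consistent oracle, so it can be compared with the compiled scheme key by key. -/
theorem inROM_accept_eq (P : ROCode lam n) (ρ : unitInterval) (N : ℕ) :
    (P.inROM.keyGen.bind fun k => (P.inROM.enc k).bind fun c => (noise ρ c).bind fun c' =>
      P.inROM.dec k c') true =
    ex (tableKey P N) fun k => ex (P.enc k.1) fun T => ex (consistentOracle k.2) fun F =>
      ex ((noise ρ (T.eval F)).bind (P.dec k.1)) fun T' => if T'.eval F then 1 else 0 := by
  have := ex_tableKey_oracle P N fun sk F => ex (P.enc sk) fun T =>
    ex ((noise ρ (T.eval F)).bind (P.dec sk)) fun T' => if T'.eval F then 1 else 0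
  rw [apply_true_eq_ex, ex_bind]
  simp only [ex_comm (P.enc _) (consistentOracle _)]
  rw [this]
  simp only [ex_bind, ROCode.inROM, ex_map]

theorem compile_accept_eq {P : ROCode lam n} {Q : ℕ} (hP : P.QueriesAtMost Q) (ρ : unitInterval)
    (τ : ℝ) :
    ((compile P Q τ).keyGen.bind fun k => ((compile P Q τ).enc k).bind fun c =>
      (noise ρ c).bind fun c' => (compile P Q τ).dec k c') true =
    ex (tableKey P ⌈lam / τ⌉₊) fun k => ex (P.enc k.1) fun T => ex (consistentOracle k.2) fun F₁ =>
      ex (consistentOracle k.2) fun F₂ =>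
        ex ((noise ρ (T.eval F₁)).bind (P.dec k.1)) fun T' => if T'.eval F₂ then 1 else 0 := by
  rw [apply_true_eq_ex, ex_bind, ← ex_compile_keyGen hP]
  refine congrArg _ (funext fun k => ?_)
  simp only [compile, ex_bind, ex_map]
  rw [ex_comm]
  congr! 4 with T F₁
  rw [ex_comm]

open Classical in
/-- The completeness loss of the compiled scheme. -/
theorem inROM_accept_le {P : ROCode lam n} {Q : ℕ} (hP : P.QueriesAtMost Q) (ρ : unitInterval)
    {τ : ℝ} (hτ : 0 < τ) :
    (P.inROM.keyGen.bind fun k => (P.inROM.enc k).bind fun c => (noise ρ c).bind fun c' =>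
      P.inROM.dec k c') true ≤
    ((compile P Q τ).keyGen.bind fun k => ((compile P Q τ).enc k).bind fun c =>
      (noise ρ c).bind fun c' => (compile P Q τ).dec k c') true +
    (ENNReal.ofReal ((2⁻¹ : ℝ) ^ lam * Q / τ) +
    (ENNReal.ofReal (Q * τ ^ ((1 / 2 : ℝ) * ((1 - (ρ : ℝ) ^ 2) / (1 + (ρ : ℝ) ^ 2)))) +
      Q * ex (tableKey P ⌈lam / τ⌉₊) fun k => ENNReal.ofReal (distUniform (encLaw P k.1 k.2)))) := by
  rw [inROM_accept_eq P ρ ⌈lam / τ⌉₊, compile_accept_eq hP]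
  -- Heaviness here refers to the decoder's fresh oracle, whereas the miss bound concerns the oracle
  -- behind the table; lazy sampling identifies the two.
  have hmiss : (ex (tableKey P ⌈lam / τ⌉₊) fun k => ex (consistentOracle k.2) fun F =>
      if Misses P τ k.1 F k.2 then 1 else 0) ≤ ENNReal.ofReal ((2⁻¹ : ℝ) ^ lam * Q / τ) := by
    rw [ex_tableKey_consistentOracle P _ fun k F => if Misses P τ k.1 F k.2 then 1 else 0]
    exact ex_keyGen_misses_le hP hτ
  refine le_trans ?_ (add_le_add_right (add_le_add_left hmiss _) _)
  rw [← ex_const_mul, ← ex_const (tableKey P ⌈lam / τ⌉₊) (ENNReal.ofReal (Q * τ ^ _)), ← ex_add,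
    ← ex_add, ← ex_add]
  refine ex_le_ex _ fun k hk => ?_
  have h1 := ex_collision_le hP ρ hτ (mem_support_tableKey hP hk).1 k.2
  rw [ENNReal.ofReal_add (by positivity)
    (mul_nonneg (Nat.cast_nonneg _) (distUniform_nonneg _)), ENNReal.ofReal_mul (Nat.cast_nonneg Q),
    ENNReal.ofReal_mul (Nat.cast_nonneg Q), ENNReal.ofReal_natCast] at h1
  rw [ENNReal.ofReal_mul (Nat.cast_nonneg Q), ENNReal.ofReal_natCast]
  refine le_trans ?_ (add_le_add_right h1 _)
  rw [← ex_add]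
  refine ex_le_ex _ fun T _ => ?_
  refine (ex_shared_oracle_le k.2 T fun c => (noise ρ c).bind (P.dec k.1)).trans (le_of_eq ?_)
  simp only [ex_add]

end completeness

/-! ### Pseudorandomness and soundness of the compiled scheme -/

section pseudorandomness

variable {lam n : ℕ}

theorem sum_toReal_eq_one {α : Type} [Fintype α] (p : PMF α) : ∑ a, (p a).toReal = 1 := by
  rw [← ENNReal.toReal_sum fun a _ => p.apply_ne_top a, ← tsum_fintype (L := .unconditional _),
    p.tsum_coe, ENNReal.toReal_one]

theorem Code.Pseudorandom.nonneg {K : Type} {P : Code K n} {q : ℕ∞} {ε : ℝ}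
    (h : P.Pseudorandom q ε) : 0 ≤ ε :=
  (abs_nonneg _).trans (h 0 (by simp) fun _ => PMF.pure true)

theorem inROM_enc (P : ROCode lam n) (k : List Bool × Oracle lam) :
    P.inROM.enc k = (P.enc k.1).map fun T => T.eval k.2 := rfl

theorem inROM_dec (P : ROCode lam n) (k : List Bool × Oracle lam) (c : Word n) :
    P.inROM.dec k c = (P.dec k.1 c).map fun T => T.eval k.2 := rfl

theorem ex_inROM_iid_enc (P : ROCode lam n) (N m : ℕ) (φ : (Fin m → Word n) → ℝ≥0∞) :
    (ex P.inROM.keyGen fun k => ex (iid (P.inROM.enc k) m) φ) =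
      ex (tableKey P N) fun k => ex (consistentOracle k.2) fun F =>
        ex (iid ((P.enc k.1).map fun T => T.eval F) m) φ := by
  rw [ex_tableKey_oracle P N fun sk F => ex (iid ((P.enc sk).map fun T => T.eval F) m) φ]
  simp only [inROM_enc]

theorem compile_enc (P : ROCode lam n) (Q : ℕ) (τ : ℝ) (k : List Bool) :
    (compile P Q τ).enc k = encLaw P (parseKey lam (Q * ⌈lam / τ⌉₊) k).1
      (parseKey lam (Q * ⌈lam / τ⌉₊) k).2 := rfl

theorem compile_dec (P : ROCode lam n) (Q : ℕ) (τ : ℝ) (k : List Bool) (c : Word n) :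
    (compile P Q τ).dec k c =
      (consistentOracle (parseKey lam (Q * ⌈lam / τ⌉₊) k).2).bind fun F =>
        (P.dec (parseKey lam (Q * ⌈lam / τ⌉₊) k).1 c).map fun T => T.eval F := rfl

/-- A single codeword has exactly its law in the random oracle model. With two or more the argument
stops, as the original encodings share their oracle and the compiled ones do not. -/
theorem compile_pseudorandom_one {P : ROCode lam n} {Q : ℕ} (hP : P.QueriesAtMost Q) (τ : ℝ)
    {q : ℕ∞} (hq : 1 ≤ q) {ε : ℝ} (h : P.inROM.Pseudorandom q ε) :
    (compile P Q τ).Pseudorandom 1 ε := by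
  intro m hm A
  have hlaw : ∀ φ : (Fin m → Word n) → ℝ≥0∞,
      (ex (compile P Q τ).keyGen fun k => ex (iid ((compile P Q τ).enc k) m) φ) =
        ex P.inROM.keyGen fun k => ex (iid (P.inROM.enc k) m) φ := by
    intro φ
    have hm' : m ≤ 1 := by exact_mod_cast hm
    interval_cases m
    · simp only [ex_iid_zero, ex_const]
    · rw [ex_inROM_iid_enc P ⌈lam / τ⌉₊]
      simp only [ex_iid_one, compile_enc]
      rw [ex_compile_keyGen hP τ fun k => ex (encLaw P k.1 k.2) fun a => φ fun _ => a]
      simp only [encLaw, ex_bind]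
  have : ((compile P Q τ).keyGen.bind fun k => (iid ((compile P Q τ).enc k) m).bind A) =
      P.inROM.keyGen.bind fun k => (iid (P.inROM.enc k) m).bind A :=
    bind_eq_of_ex fun φ => by simpa only [ex_bind] using hlaw fun v => ex (A v) φ
  rw [this]
  exact h m (hm.trans hq) A

theorem QueryTree.eval_eq_of_queriesAtMost_zero {α : Type} {T : QueryTree lam α}
    (hT : T.QueriesAtMost 0) (F F' : Oracle lam) : T.eval F' = T.eval F := by
  refine QueryTree.eval_congr fun x ⟨b, hb⟩ => ?_
  rw [List.length_eq_zero_iff.1 (Nat.le_zero.1 (hT F))] at hb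
  simp at hb

theorem map_congr_support {α β : Type} {p : PMF α} {f g : α → β} (h : ∀ a ∈ p.support, f a = g a) :
    p.map f = p.map g := by
  classical
  ext b
  rw [apply_eq_ex, apply_eq_ex, ex_map, ex_map]
  exact ex_congr p fun a ha => by rw [h a ha]

/-- A scheme without oracle queries stays pseudorandom. -/
theorem compile_pseudorandom_of_no_queries {P : ROCode lam n} (hP : P.QueriesAtMost 0) (τ : ℝ)
    {q : ℕ∞} {ε : ℝ} (h : P.inROM.Pseudorandom q ε) : (compile P 0 τ).Pseudorandom q ε := by
  intro m hm A
  have henc : ∀ sk ∈ P.keyGen.support, ∀ F : Oracle lam,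
      ((P.enc sk).map fun T => T.eval F) = (P.enc sk).map fun T => T.eval fun _ => false :=
    fun sk hsk F => map_congr_support fun T hT =>
      QueryTree.eval_eq_of_queriesAtMost_zero ((hP sk hsk).1 T hT) _ F
  have hlaw : ∀ φ : (Fin m → Word n) → ℝ≥0∞,
      (ex (compile P 0 τ).keyGen fun k => ex (iid ((compile P 0 τ).enc k) m) φ) =
        ex P.inROM.keyGen fun k => ex (iid (P.inROM.enc k) m) φ := by
    intro φ
    rw [ex_inROM_iid_enc P ⌈lam / τ⌉₊]
    simp only [compile_enc]
    rw [ex_compile_keyGen hP τ fun k => ex (iid (encLaw P k.1 k.2) m) φ]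
    refine ex_congr _ fun k hk => ?_
    have hsk := (mem_support_tableKey hP hk).1
    simp only [encLaw, henc k.1 hsk, ex_const, PMF.bind_const]
  have : ((compile P 0 τ).keyGen.bind fun k => (iid ((compile P 0 τ).enc k) m).bind A) =
      P.inROM.keyGen.bind fun k => (iid (P.inROM.enc k) m).bind A :=
    bind_eq_of_ex fun φ => by simpa only [ex_bind] using hlaw fun v => ex (A v) φ
  rw [this]
  exact h m hm A

/-- Soundness concerns one decoder run on a fixed word, whose law is the same in both schemes. -/
theorem compile_sound {P : ROCode lam n} {Q : ℕ} (hP : P.QueriesAtMost Q) (τ : ℝ) {μ : ℝ}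
    (h : P.inROM.Sound μ) : (compile P Q τ).Sound μ := by
  intro c
  have : ((compile P Q τ).keyGen.bind fun k => (compile P Q τ).dec k c) =
      P.inROM.keyGen.bind fun k => P.inROM.dec k c := by
    refine bind_eq_of_ex fun φ => ?_
    simp only [compile_dec, inROM_dec]
    rw [ex_compile_keyGen hP τ fun k => ex ((consistentOracle k.2).bind fun F =>
      (P.dec k.1 c).map fun T => T.eval F) φ]
    simp only [ex_bind]
    rw [ex_tableKey_oracle P _ fun sk F => ex ((P.dec sk c).map fun T => T.eval F) φ]
  rw [this]
  exact h c

theorem ex_le_ex_uniform_add (M : PMF (Word n)) {h : Word n → ℝ≥0∞} (hh : ∀ c, h c ≤ 1) :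
    ex M h ≤ ex (PMF.uniformOfFintype (Word n)) h + ENNReal.ofReal (distUniform M) := by
  rw [ex_eq_sum, ex_eq_sum, distUniform, ENNReal.ofReal_sum_of_nonneg fun c _ => le_max_right _ _,
    ← Finset.sum_add_distrib]
  refine Finset.sum_le_sum fun c _ => ?_
  have h1 : M c ≤ PMF.uniformOfFintype (Word n) c +
      ENNReal.ofReal (max ((M c).toReal - (2 ^ n)⁻¹) 0) := by
    have hu : PMF.uniformOfFintype (Word n) c = ENNReal.ofReal ((2 ^ n)⁻¹) := by
      rw [PMF.uniformOfFintype_apply, ENNReal.ofReal_inv_of_pos (by positivity)]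
      simp [ENNReal.ofReal_pow]
    rw [hu, ← ENNReal.ofReal_add (by positivity) (le_max_right _ _),
      ENNReal.le_ofReal_iff_toReal_le (M.apply_ne_top c)
        (add_nonneg (by positivity) (le_max_right _ _))]
    linarith [le_max_left ((M c).toReal - (2 ^ n)⁻¹) 0]
  calc M c * h c ≤ (PMF.uniformOfFintype (Word n) c +
        ENNReal.ofReal (max ((M c).toReal - (2 ^ n)⁻¹) 0)) * h c := by gcongr
    _ ≤ _ := by
      rw [add_mul]
      gcongr
      exact mul_le_of_le_one_right' (hh c)

/-- The optimal distinguisher, which accepts the tuples that are at least as likely as under the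
uniform law, has the total variation distance as its advantage. -/
theorem sum_max_le_of_pseudorandom {K : Type} {P : Code K n} {q : ℕ∞} {ε : ℝ}
    (h : P.Pseudorandom q ε) {m : ℕ} (hm : (m : ℕ∞) ≤ q) :
    ∑ c, max (((P.keyGen.bind fun k => iid (P.enc k) m) c).toReal - (((2 : ℝ) ^ n) ^ m)⁻¹) 0 ≤
      ε := by
  classical
  set p := P.keyGen.bind fun k => iid (P.enc k) m with hp
  set u : ℝ := (((2 : ℝ) ^ n) ^ m)⁻¹ with hu
  set A : (Fin m → Word n) → PMF Bool := fun c => PMF.pure (decide (u ≤ (p c).toReal)) with hA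
  have hprob : ∀ r : PMF (Fin m → Word n), prob (r.bind A) true =
      ∑ c, if u ≤ (p c).toReal then (r c).toReal else 0 := by
    intro r
    rw [prob, apply_true_eq_ex, ex_bind, ex_eq_sum, ENNReal.toReal_sum]
    · refine Finset.sum_congr rfl fun c _ => ?_
      rw [hA, ex_pure]
      by_cases hc : u ≤ (p c).toReal <;> simp [hc]
    · intro c _
      refine ENNReal.mul_ne_top (r.apply_ne_top c) ?_
      rw [hA, ex_pure]
      split_ifs <;> simp
  have h1 := h m hm A
  rw [← PMF.bind_bind, ← hp, hprob, hprob, iid_uniform, ← Finset.sum_sub_distrib] at h1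
  refine le_trans (le_of_eq ?_) ((le_abs_self _).trans h1)
  refine Finset.sum_congr rfl fun c _ => ?_
  have hunif : (PMF.uniformOfFintype (Fin m → Word n) c).toReal = u := by
    simp [hu]
  rw [hunif]
  split_ifs with hc
  · exact max_eq_left (by linarith)
  · rw [sub_zero]
    exact max_eq_right (by linarith)

/-- A finite set that contains all bit strings of length at most `L`. -/
noncomputable def shortStrings (L : ℕ) : Finset (List Bool) :=
  open Classical in
  Finset.univ.image fun p : Fin (L + 1) × Word L => (List.ofFn p.2).take p.1

theorem mem_shortStrings {L : ℕ} {k : List Bool} (hk : k.length ≤ L) : k ∈ shortStrings L := by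
  rw [shortStrings, Finset.mem_image]
  refine ⟨(⟨k.length, by omega⟩, fun i => k.getD i false), Finset.mem_univ _, ?_⟩
  refine List.ext_getElem (by simp [hk]) fun i h1 h2 => ?_
  simp [h2]

theorem log_card_shortStrings_le (L : ℕ) : Real.log (shortStrings L).card ≤ 2 * L := by
  have h1 : (shortStrings L).card ≤ (L + 1) * 2 ^ L := by
    refine Finset.card_image_le.trans ?_
    simp
  rcases Nat.eq_zero_or_pos (shortStrings L).card with h0 | h0
  · rw [h0]; simp
  · have h2 : ((shortStrings L).card : ℝ) ≤ (L + 1) * 2 ^ L := by exact_mod_cast h1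
    refine (Real.log_le_log (by exact_mod_cast h0) h2).trans ?_
    rw [Real.log_mul (by positivity) (by positivity), Real.log_pow]
    have h3 := Real.log_le_sub_one_of_pos (by positivity : (0 : ℝ) < L + 1)
    have h4 := Real.log_le_sub_one_of_pos (by norm_num : (0 : ℝ) < 2)
    nlinarith [(Nat.cast_nonneg L : (0 : ℝ) ≤ L)]

theorem sum_mul_apply_eq {α : Type} [Fintype α] {m : ℕ} {W : PMF (Fin m → α)} {D : PMF α}
    {i : Fin m} (h : W.map (fun c => c i) = D) (φ : α → ℝ) :
    ∑ c, (W c).toReal * φ (c i) = ∑ a, (D a).toReal * φ a := by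
  classical
  have hD : ∀ a, (D a).toReal = ∑ c, if c i = a then (W c).toReal else 0 := by
    intro a
    rw [← h, apply_eq_ex, ex_map, ex_eq_sum, ENNReal.toReal_sum]
    · exact Finset.sum_congr rfl fun c _ => by split_ifs <;> simp
    · intro c _
      refine ENNReal.mul_ne_top (W.apply_ne_top c) ?_
      split_ifs <;> simp
  simp only [hD, Finset.sum_mul]
  rw [Finset.sum_comm]
  simp [ite_mul]

/-- Many pseudorandom codewords per key bit force each codeword to be close to uniform given the
key. -/
theorem average_distUniform_le {P : ROCode lam n} {Q : ℕ} (hP : P.QueriesAtMost Q) (τ : ℝ)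
    {q : ℕ∞} {ε : ℝ} (h : P.inROM.Pseudorandom q ε) {L : ℕ}
    (hL : ∀ k ∈ (compile P Q τ).keyGen.support, k.length ≤ L) {m : ℕ} (hm0 : 0 < m)
    (hm : (m : ℕ∞) ≤ q) :
    (ex (tableKey P ⌈lam / τ⌉₊) fun k => ENNReal.ofReal (distUniform (encLaw P k.1 k.2))) ≤
      ENNReal.ofReal (√((2 * L + ε * (m * n + 1)) / m)) := by
  set K := (compile P Q τ).keyGen with hK
  set s := shortStrings L with hs
  have hKs : ∀ k ∈ K.support, k ∈ s := fun k hk => mem_shortStrings (hL k hk)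
  -- `W k` uses one consistent oracle for all `m` codewords, so that averaging over keys gives the
  -- original joint law (`hlaw`), while each marginal is the compiled encoder `D k`.
  set W : List Bool → PMF (Fin m → Word n) := fun k =>
    (consistentOracle (parseKey lam (Q * ⌈lam / τ⌉₊) k).2).bind fun F =>
      iid ((P.enc (parseKey lam (Q * ⌈lam / τ⌉₊) k).1).map fun T => T.eval F) m with hW
  set D := (compile P Q τ).enc with hD
  have hWD : ∀ k i, (W k).map (fun c => c i) = D k := by
    classical
    intro k i
    ext a
    rw [apply_eq_ex, apply_eq_ex, ex_map, hW, hD, compile_enc, encLaw, ex_bind, ex_bind]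
    congr! 2 with F
    exact ex_iid_apply _ m i fun x => if x = a then 1 else 0
  have hlaw : K.bind W = P.inROM.keyGen.bind fun k => iid (P.inROM.enc k) m := by
    refine bind_eq_of_ex fun φ => ?_
    rw [ex_inROM_iid_enc P ⌈lam / τ⌉₊]
    simp only [hW, ex_bind]
    rw [hK, ex_compile_keyGen hP τ fun k => ex (consistentOracle k.2) fun F =>
      ex (iid ((P.enc k.1).map fun T => T.eval F) m) φ]
  have hw1 : ∑ k ∈ s, (K k).toReal = 1 := by
    rw [← ENNReal.toReal_sum fun k _ => K.apply_ne_top k]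
    have := ex_const K 1
    rw [ex_le_support_sum K s hKs] at this
    simp only [mul_one] at this
    rw [this, ENNReal.toReal_one]
  have hη := sum_max_le_of_pseudorandom h hm
  rw [← hlaw] at hη
  have key := sq_average_distance_le hm0 s (w := fun k => (K k).toReal)
    (fun k => ENNReal.toReal_nonneg) hw1 (W := fun k c => (W k c).toReal)
    (fun k c => ENNReal.toReal_nonneg) (fun k => sum_toReal_eq_one (W k))
    (D := fun k a => (D k a).toReal) (fun k a => ENNReal.toReal_nonneg)
    (fun k => sum_toReal_eq_one (D k)) (fun k i φ => sum_mul_apply_eq (hWD k i) φ)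
    (P := fun c => (K.bind W c).toReal) (fun c => ?_) (M := 2 ^ n) (by simp) hη
  · rw [← ex_compile_keyGen hP τ fun k => ENNReal.ofReal (distUniform (encLaw P k.1 k.2)),
      ex_le_support_sum K s hKs]
    have hsum : ∑ k ∈ s, K k * ENNReal.ofReal (distUniform (encLaw P
        (parseKey lam (Q * ⌈lam / τ⌉₊) k).1 (parseKey lam (Q * ⌈lam / τ⌉₊) k).2)) =
        ENNReal.ofReal (∑ k ∈ s, (K k).toReal * distUniform (D k)) := by
      rw [ENNReal.ofReal_sum_of_nonneg fun k _ =>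
        mul_nonneg ENNReal.toReal_nonneg (distUniform_nonneg _)]
      refine Finset.sum_congr rfl fun k _ => ?_
      rw [ENNReal.ofReal_mul ENNReal.toReal_nonneg, ENNReal.ofReal_toReal (K.apply_ne_top k)]
      rfl
    rw [hsum]
    refine ENNReal.ofReal_le_ofReal (Real.le_sqrt_of_sq_le (key.trans ?_))
    have h1 := log_card_shortStrings_le L
    have h2 := Real.log_le_sub_one_of_pos (by norm_num : (0 : ℝ) < 2)
    have h3 : (m : ℝ) * Real.log (2 ^ n) ≤ m * n := by
      rw [Real.log_pow]
      gcongr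
      nlinarith [(Nat.cast_nonneg n : (0 : ℝ) ≤ n)]
    have := h.nonneg
    gcongr
  · rw [bind_apply_eq_ex, ex_le_support_sum K s hKs, ENNReal.toReal_sum fun k _ =>
      ENNReal.mul_ne_top (K.apply_ne_top k) ((W k).apply_ne_top c)]
    simp only [ENNReal.toReal_mul]

theorem average_distUniform_le_sqrt {P : ROCode lam n} {Q : ℕ} (hlam : 1 ≤ lam) (hQ : 1 ≤ Q)
    (hP : P.QueriesAtMost Q) {τ : ℝ} (hτ0 : 0 < τ) (hτ1 : τ < 1) {q : ℕ∞} {ε : ℝ}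
    (h : P.inROM.Pseudorandom q ε) {ℓ : ℕ} (hℓ : ∀ sk ∈ P.keyGen.support, sk.length ≤ ℓ)
    (hq : q = ⊤ ∨ ∃ m : ℕ, (m : ℕ∞) ≤ q ∧ (ℓ : ℝ) + Q * (lam : ℝ) ^ 2 / τ ≤ m * (ε * n)) :
    (ex (tableKey P ⌈lam / τ⌉₊) fun k => ENNReal.ofReal (distUniform (encLaw P k.1 k.2))) ≤
      ENNReal.ofReal (4 * √(ε * n)) := by
  have hε := h.nonneg
  set L := ℓ + Q * ⌈lam / τ⌉₊ * (lam + 2) with hL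
  have hlen : ∀ k ∈ (compile P Q τ).keyGen.support, k.length ≤ L := fun k hk =>
    length_of_mem_compile_keyGen hℓ hP hk
  rcases hq with rfl | ⟨m, hmq, hm⟩
  -- Without a query bound, letting the number `m + 1` of codewords grow makes the key length
  -- negligible.
  · have hbound : ∀ m : ℕ, (ex (tableKey P ⌈lam / τ⌉₊) fun k =>
        ENNReal.ofReal (distUniform (encLaw P k.1 k.2))) ≤
        ENNReal.ofReal (√((2 * L + ε) * (1 / ((m : ℝ) + 1)) + ε * n)) := by
      intro m
      refine (average_distUniform_le hP τ h hlen m.succ_pos le_top).trans (le_of_eq ?_)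
      congr 2
      push_cast
      field_simp
      ring
    have hlim : Filter.Tendsto (fun m : ℕ =>
        ENNReal.ofReal (√((2 * L + ε) * (1 / ((m : ℝ) + 1)) + ε * n))) Filter.atTop
        (nhds (ENNReal.ofReal (√((2 * L + ε) * 0 + ε * n)))) :=
      ENNReal.tendsto_ofReal (((tendsto_one_div_add_atTop_nhds_zero_nat.const_mul _).add_const
        _).sqrt)
    refine (ge_of_tendsto' hlim hbound).trans (ENNReal.ofReal_le_ofReal ?_)
    rw [mul_zero, zero_add]
    linarith [Real.sqrt_nonneg (ε * n)]
  · have hQ' : (1 : ℝ) ≤ Q := by exact_mod_cast hQ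
    have hl : (1 : ℝ) ≤ lam := by exact_mod_cast hlam
    -- This is where `Q ≥ 1` is used: it excludes the degenerate cases `m = 0` and `n = 0`.
    have hB : 0 < (Q : ℝ) * (lam : ℝ) ^ 2 / τ := by positivity
    have hpos : 0 < (m : ℝ) * (ε * n) := by
      linarith [(Nat.cast_nonneg ℓ : (0 : ℝ) ≤ ℓ)]
    have hm0 : 0 < m := by
      rcases Nat.eq_zero_or_pos m with rfl | h0
      · simp at hpos
      · exact h0
    have hn0 : 0 < n := by
      rcases Nat.eq_zero_or_pos n with rfl | h0
      · simp at hpos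
      · exact h0
    refine (average_distUniform_le hP τ h hlen hm0 hmq).trans (ENNReal.ofReal_le_ofReal ?_)
    have hL' : (L : ℝ) ≤ 6 * (m * (ε * n)) := by
      have := mul_ceil_le (Q := Q) hlam hτ0 hτ1
      rw [hL, Nat.cast_add]
      linarith [(Nat.cast_nonneg ℓ : (0 : ℝ) ≤ ℓ)]
    have hm1 : (1 : ℝ) ≤ m := by exact_mod_cast hm0
    have hn1 : (1 : ℝ) ≤ n := by exact_mod_cast hn0
    rw [Real.sqrt_le_left (by positivity), mul_pow, Real.sq_sqrt (by positivity),
      div_le_iff₀ (by positivity)]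
    -- The key contributes `2L ≤ 12 mεn` and the codewords `ε(mn+1) ≤ 2mεn`; the total `14` is below
    -- `4² = 16`.
    have h1 : 1 ≤ (m : ℝ) * n := by nlinarith
    nlinarith [mul_le_mul_of_nonneg_left h1 hε]

end pseudorandomness

/-! ### The compiled scheme is a pseudorandom code -/

section main

variable {lam n : ℕ}

/-- The compiled scheme with a given encoder. -/
noncomputable def withEncoder {K : Type} (P : Code K n) (enc : K → PMF (Word n)) : Code K n where
  keyGen := P.keyGen
  enc := enc
  dec := P.dec

theorem complete_of_le {K K' : Type} {P : Code K n} {P' : Code K' n} {ρ : unitInterval}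
    {δ e : ℝ} (he : 0 ≤ e) (h : P.Complete ρ δ)
    (hle : (P.keyGen.bind fun k => (P.enc k).bind fun c => (noise ρ c).bind fun c' =>
      P.dec k c') true ≤ (P'.keyGen.bind fun k => (P'.enc k).bind fun c =>
        (noise ρ c).bind fun c' => P'.dec k c') true + ENNReal.ofReal e) :
    P'.Complete ρ (δ + e) := by
  unfold Code.Complete prob at *
  have := ENNReal.toReal_mono (ENNReal.add_ne_top.2 ⟨PMF.apply_ne_top _ _,
    ENNReal.ofReal_ne_top⟩) hle
  rw [ENNReal.toReal_add (PMF.apply_ne_top _ _) ENNReal.ofReal_ne_top,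
    ENNReal.toReal_ofReal he] at this
  linarith

theorem Code.Complete.mono {K : Type} {P : Code K n} {ρ : unitInterval} {δ δ' : ℝ}
    (h : P.Complete ρ δ) (hδ : δ ≤ δ') : P.Complete ρ δ' := by
  unfold Code.Complete at *
  linarith

/-- The loss in completeness, before simplification. -/
noncomputable def rawLoss (ρ : ℝ) (lam n Q : ℕ) (τ ε : ℝ) : ℝ :=
  (2⁻¹ : ℝ) ^ lam * Q / τ + (Q * τ ^ ((1 / 2 : ℝ) * ((1 - ρ ^ 2) / (1 + ρ ^ 2))) +
    Q * (4 * √(ε * n)))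

theorem rawLoss_nonneg (ρ : ℝ) (lam n Q : ℕ) {τ : ℝ} (hτ0 : 0 < τ) (ε : ℝ) :
    0 ≤ rawLoss ρ lam n Q τ ε := by
  unfold rawLoss
  positivity

theorem compile_accept_ge {P : ROCode lam n} {Q : ℕ} (hlam : 1 ≤ lam)
    (hP : P.QueriesAtMost Q) (ρ : unitInterval) {τ : ℝ} (hτ0 : 0 < τ) (hτ1 : τ < 1) {q : ℕ∞}
    {ε : ℝ} (h : P.inROM.Pseudorandom q ε) {ℓ : ℕ}
    (hℓ : ∀ sk ∈ P.keyGen.support, sk.length ≤ ℓ)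
    (hq : q = ⊤ ∨ ∃ m : ℕ, (m : ℕ∞) ≤ q ∧ (ℓ : ℝ) + Q * (lam : ℝ) ^ 2 / τ ≤ m * (ε * n)) :
    (P.inROM.keyGen.bind fun k => (P.inROM.enc k).bind fun c => (noise ρ c).bind fun c' =>
      P.inROM.dec k c') true ≤
    ((compile P Q τ).keyGen.bind fun k => ((compile P Q τ).enc k).bind fun c =>
      (noise ρ c).bind fun c' => (compile P Q τ).dec k c') true +
    ENNReal.ofReal (rawLoss ρ lam n Q τ ε) := by
  refine (inROM_accept_le hP ρ hτ0).trans ?_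
  unfold rawLoss
  rw [ENNReal.ofReal_add (by positivity) (by positivity),
    ENNReal.ofReal_add (by positivity) (by positivity),
    ENNReal.ofReal_mul (p := (Q : ℝ)) (q := 4 * √(ε * n)) (Nat.cast_nonneg Q),
    ENNReal.ofReal_natCast]
  refine add_le_add_right (add_le_add_right (add_le_add_right ?_ _) _) _
  rcases Nat.eq_zero_or_pos Q with rfl | hQ
  · simp
  · gcongr
    exact average_distUniform_le_sqrt hlam hQ hP hτ0 hτ1 h hℓ hq

theorem le_natCast_sq (Q : ℕ) : (Q : ℝ) ≤ (Q : ℝ) ^ 2 := by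
  exact_mod_cast Nat.le_self_pow two_ne_zero Q

/-- The constant is `8 = 4 + 4`: one distance is paid in the collision bound, the other when the
codeword is replaced by a uniform word. -/
theorem add_rawLoss_le (ρ : ℝ) (lam n Q : ℕ) {τ : ℝ} (hτ0 : 0 < τ) (δ ε : ℝ) :
    δ + rawLoss ρ lam n Q τ ε + Q * (4 * √(ε * n)) ≤ compiledError 8 ρ lam n Q τ δ ε := by
  unfold rawLoss compiledError
  have h1 := mul_le_mul_of_nonneg_right (le_natCast_sq Q)
    (Real.rpow_nonneg hτ0.le ((1 / 2 : ℝ) * ((1 - ρ ^ 2) / (1 + ρ ^ 2))))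
  have h2 := mul_le_mul_of_nonneg_right (le_natCast_sq Q) (Real.sqrt_nonneg (ε * n))
  linarith

theorem compile_isPRC {P : ROCode lam n} {Q : ℕ} (hlam : 1 ≤ lam)
    (hP : P.QueriesAtMost Q) {ρ : unitInterval} {τ : ℝ} (hτ0 : 0 < τ) (hτ1 : τ < 1) {q : ℕ∞}
    {δ ε μ : ℝ} (h : P.inROM.IsPRC ρ q δ ε μ) {ℓ : ℕ}
    (hℓ : ∀ sk ∈ P.keyGen.support, sk.length ≤ ℓ) (hq1 : 1 ≤ q)
    (hq : q = ⊤ ∨ ∃ m : ℕ, (m : ℕ∞) ≤ q ∧ (ℓ : ℝ) + Q * (lam : ℝ) ^ 2 / τ ≤ m * (ε * n)) :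
    (compile P Q τ).IsPRC ρ 1 (compiledError 8 ρ lam n Q τ δ ε) ε μ where
  complete := (complete_of_le (rawLoss_nonneg _ _ _ _ hτ0 _) h.complete
    (compile_accept_ge hlam hP ρ hτ0 hτ1 h.pseudorandom hℓ hq)).mono (by
      have := add_rawLoss_le ρ lam n Q hτ0 δ ε
      have h0 : 0 ≤ (Q : ℝ) * (4 * √(ε * n)) := by positivity
      linarith)
  pseudorandom := compile_pseudorandom_one hP τ hq1 h.pseudorandom
  sound := compile_sound hP τ h.sound

theorem compile_accept_le_uniform {P : ROCode lam n} {Q : ℕ} (hP : P.QueriesAtMost Q)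
    (ρ : unitInterval) (τ : ℝ) :
    ((compile P Q τ).keyGen.bind fun k => ((compile P Q τ).enc k).bind fun c =>
      (noise ρ c).bind fun c' => (compile P Q τ).dec k c') true ≤
    ((compile P Q τ).keyGen.bind fun k => (PMF.uniformOfFintype (Word n)).bind fun c =>
      (noise ρ c).bind fun c' => (compile P Q τ).dec k c') true +
    ex (tableKey P ⌈lam / τ⌉₊) fun k => ENNReal.ofReal (distUniform (encLaw P k.1 k.2)) := by
  rw [← ex_compile_keyGen hP τ fun k => ENNReal.ofReal (distUniform (encLaw P k.1 k.2)),
    bind_apply_eq_ex, bind_apply_eq_ex, ← ex_add]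
  refine ex_le_ex _ fun k _ => ?_
  rw [bind_apply_eq_ex, bind_apply_eq_ex]
  exact ex_le_ex_uniform_add _ fun c => PMF.coe_le_one _ _

/-- With uniform codewords the compiled scheme is pseudorandom against all adversaries, and it stays
complete if the scheme makes queries. -/
theorem withEncoder_uniform_isPRC {P : ROCode lam n} {Q : ℕ} (hlam : 1 ≤ lam) (hQ : 1 ≤ Q)
    (hP : P.QueriesAtMost Q) {ρ : unitInterval} {τ : ℝ} (hτ0 : 0 < τ) (hτ1 : τ < 1) {q : ℕ∞}
    {δ ε μ : ℝ} (h : P.inROM.IsPRC ρ q δ ε μ) {ℓ : ℕ}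
    (hℓ : ∀ sk ∈ P.keyGen.support, sk.length ≤ ℓ)
    (hq : q = ⊤ ∨ ∃ m : ℕ, (m : ℕ∞) ≤ q ∧ (ℓ : ℝ) + Q * (lam : ℝ) ^ 2 / τ ≤ m * (ε * n)) :
    (withEncoder (compile P Q τ) fun _ => PMF.uniformOfFintype (Word n)).IsPRC ρ q
      (compiledError 8 ρ lam n Q τ δ ε) ε μ where
  complete := by
    have h4 : (0 : ℝ) ≤ 4 * √(ε * n) := by positivity
    refine (complete_of_le (P := P.inROM) (add_nonneg (rawLoss_nonneg ρ lam n Q hτ0 ε) h4)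
      h.complete ?_).mono ?_
    · refine (compile_accept_ge hlam hP ρ hτ0 hτ1 h.pseudorandom hℓ hq).trans ?_
      rw [add_comm (rawLoss _ _ _ _ _ _), ENNReal.ofReal_add h4 (rawLoss_nonneg _ _ _ _ hτ0 _),
        ← add_assoc]
      gcongr
      refine (compile_accept_le_uniform hP ρ τ).trans ?_
      exact add_le_add_right
        (average_distUniform_le_sqrt hlam hQ hP hτ0 hτ1 h.pseudorandom hℓ hq) _
    · have := add_rawLoss_le ρ lam n Q hτ0 δ ε
      have hQ' : (1 : ℝ) ≤ Q := by exact_mod_cast hQ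
      nlinarith
  pseudorandom := by
    intro m _ A
    simp only [withEncoder, PMF.bind_const, sub_self, abs_zero]
    exact h.pseudorandom.nonneg
  sound := compile_sound hP τ h.sound

theorem compile_isPRC_of_no_queries {P : ROCode lam n} (hlam : 1 ≤ lam)
    (hP : P.QueriesAtMost 0) {ρ : unitInterval} {τ : ℝ} (hτ0 : 0 < τ) (hτ1 : τ < 1) {q : ℕ∞}
    {δ ε μ : ℝ} (h : P.inROM.IsPRC ρ q δ ε μ) {ℓ : ℕ}
    (hℓ : ∀ sk ∈ P.keyGen.support, sk.length ≤ ℓ) (hq1 : 1 ≤ q)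
    (hq : q = ⊤ ∨ ∃ m : ℕ, (m : ℕ∞) ≤ q ∧
      (ℓ : ℝ) + (0 : ℕ) * (lam : ℝ) ^ 2 / τ ≤ m * (ε * n)) :
    (compile P 0 τ).IsPRC ρ q (compiledError 8 ρ lam n 0 τ δ ε) ε μ where
  complete := (compile_isPRC hlam hP hτ0 hτ1 h hℓ hq1 hq).complete
  pseudorandom := compile_pseudorandom_of_no_queries hP τ h.pseudorandom
  sound := compile_sound hP τ h.sound

/-- The encoder of the compiled scheme for adversaries that make many queries. -/
noncomputable def manyTimeEncoder (P : ROCode lam n) (Q : ℕ) (τ : ℝ) : List Bool → PMF (Word n) :=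
  -- For `Q = 0` the allowed extra error is zero, which leaves no room for replacing the codeword by
  -- a uniform one.
  if Q = 0 then (compile P Q τ).enc else fun _ => PMF.uniformOfFintype (Word n)

theorem manyTimeEncoder_isPRC {P : ROCode lam n} {Q : ℕ} (hlam : 1 ≤ lam)
    (hP : P.QueriesAtMost Q) {ρ : unitInterval} {τ : ℝ} (hτ0 : 0 < τ) (hτ1 : τ < 1) {q : ℕ∞}
    {δ ε μ : ℝ} (h : P.inROM.IsPRC ρ q δ ε μ) {ℓ : ℕ}
    (hℓ : ∀ sk ∈ P.keyGen.support, sk.length ≤ ℓ) (hq1 : 1 ≤ q)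
    (hq : q = ⊤ ∨ ∃ m : ℕ, (m : ℕ∞) ≤ q ∧ (ℓ : ℝ) + Q * (lam : ℝ) ^ 2 / τ ≤ m * (ε * n)) :
    (withEncoder (compile P Q τ) (manyTimeEncoder P Q τ)).IsPRC ρ q
      (compiledError 8 ρ lam n Q τ δ ε) ε μ := by
  rcases Nat.eq_zero_or_pos Q with rfl | hQ
  · rw [manyTimeEncoder, if_pos rfl]
    exact compile_isPRC_of_no_queries hlam hP hτ0 hτ1 h hℓ hq1 hq
  · rw [manyTimeEncoder, if_neg hQ.ne']
    exact withEncoder_uniform_isPRC hlam hQ hP hτ0 hτ1 h hℓ hq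

end main
end PRC

theorem mainTheorem3 :
    ∃ C : ℝ, 0 < C ∧
      ∀ (n ℓ Q : ℕ → ℕ) (q : ℕ → ℕ∞) (ρ : ℕ → unitInterval) (δ ε μ τ : ℕ → ℝ)
        (P : (lam : ℕ) → PRC.ROCode lam (n lam)),
        (∀ lam ≥ 1, ∀ sk ∈ (P lam).keyGen.support, sk.length ≤ ℓ lam) →
        (∀ lam ≥ 1, (P lam).QueriesAtMost (Q lam)) →
        (∀ lam ≥ 1, (P lam).inROM.IsPRC (ρ lam) (q lam) (δ lam) (ε lam) (μ lam)) →
        (∀ lam ≥ 1, 0 < τ lam ∧ τ lam < 1) →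
        (∀ lam ≥ 1, 1 ≤ q lam ∧ (q lam = ⊤ ∨ ∃ m : ℕ, (m : ℕ∞) ≤ q lam ∧
          (ℓ lam : ℝ) + Q lam * (lam : ℝ) ^ 2 / τ lam ≤ m * (ε lam * n lam))) →
        (∃ P' : (lam : ℕ) → PRC.StdCode (n lam), ∀ lam ≥ 1,
          (P' lam).IsPRC (ρ lam) (q lam)
            (PRC.compiledError C (ρ lam) lam (n lam) (Q lam) (τ lam) (δ lam) (ε lam))
            (ε lam) (μ lam) ∧
          (∀ sk ∈ (P' lam).keyGen.support,
            (sk.length : ℝ) ≤ ℓ lam + C * (Q lam * (lam : ℝ) ^ 2 / τ lam)) ∧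
          (P' lam).keyGen = (PRC.compile (P lam) (Q lam) (τ lam)).keyGen ∧
          (P' lam).dec = (PRC.compile (P lam) (Q lam) (τ lam)).dec) ∧
        ∀ lam ≥ 1,
          (PRC.compile (P lam) (Q lam) (τ lam)).IsPRC (ρ lam) 1
            (PRC.compiledError C (ρ lam) lam (n lam) (Q lam) (τ lam) (δ lam) (ε lam))
            (ε lam) (μ lam) ∧
          PRC.missProbability (P lam) (τ lam) ≤ (2⁻¹ : ℝ) ^ lam * Q lam / τ lam := by
  -- The completeness error needs `8`; the key length would need only `6`.
  refine ⟨8, by norm_num, ?_⟩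
  intro n ℓ Q q ρ δ ε μ τ P hℓ hP hPRC hτ hq
  refine ⟨⟨fun lam => PRC.withEncoder (PRC.compile (P lam) (Q lam) (τ lam))
    (PRC.manyTimeEncoder (P lam) (Q lam) (τ lam)), fun lam hlam => ⟨?_, ?_, rfl, rfl⟩⟩,
    fun lam hlam => ⟨?_, ?_⟩⟩
  · exact PRC.manyTimeEncoder_isPRC hlam (hP lam hlam) (hτ lam hlam).1 (hτ lam hlam).2
      (hPRC lam hlam) (hℓ lam hlam) (hq lam hlam).1 (hq lam hlam).2
  · intro sk hsk
    have h1 : (sk.length : ℝ) ≤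
        ((ℓ lam + Q lam * ⌈lam / τ lam⌉₊ * (lam + 2) : ℕ) : ℝ) := by
      exact_mod_cast PRC.length_of_mem_compile_keyGen (hℓ lam hlam) (hP lam hlam) hsk
    have h2 := PRC.mul_ceil_le (Q := Q lam) hlam (hτ lam hlam).1 (hτ lam hlam).2
    have h3 : 0 ≤ (Q lam : ℝ) * (lam : ℝ) ^ 2 / τ lam :=
      div_nonneg (by positivity) (hτ lam hlam).1.le
    rw [Nat.cast_add] at h1
    linarith
  · exact PRC.compile_isPRC hlam (hP lam hlam) (hτ lam hlam).1 (hτ lam hlam).2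
      (hPRC lam hlam) (hℓ lam hlam) (hq lam hlam).1 (hq lam hlam).2
  · exact PRC.missProbability_le (hP lam hlam) (hτ lam hlam).1
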